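/- Let $n\ge 2$, let $\Omega\subset\mathbb R^n$ be a nonempty bounded open convex set, and let $u\in C^4(\Omega)\cap C^0(\overline\Omega)$, strictly convex in $\Omega$, be a solution of $$\det D^2u=1\ \text{ in }\Omega,\qquad u=0\ \text{ on }\partial\Omega .$$ Let $\sigma_2(W)$ be the second elementary symmetric function of the eigenvalues of the matrix $W$ (the sum of its principal $2\times2$ minors), let $\partial\sigma_2(D^2u)/\partial u_{kl}$ be its partial derivative with respect to the $(k,l)$ entry at $W=D^2u$ (all $n^2$ entries being independent variables), and put $$\psi=\sum_{k,l=1}^n\frac{\partial\sigma_2(D^2u)}{\partial u_{kl}}\,u_ku_l-2(n-1)u\qquad\text{in }\Omega .$$ Then $\psi$ attains its maximum on $\partial\Omega$: there is $x_0\in\partial\Omega$ with $$\psi(x)\le\limsup_{\Omega\ni y\to x_0}\psi(y)\quad\text{for all }x\in\Omega$$ (the upper limit being taken in $[-\infty,\infty]$); and, whenever $\psi$ extends to a continuous real-valued function on $\overline\Omega$, the extension attains its maximum over $\overline\Omega$ at a point of $\partial\Omega$. Moreover, $\psi$ attains its maximum in $\Omega$ (there is $x_0\in\Omega$ with $\psi(x)\le\psi(x_0)$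 for all $x\in\Omega$) if and only if $\Omega$ is an ellipse when $n=2$, that is $\Omega=\{x:(x-c)^{T}A(x-c)<1\}$ for some $c\in\mathbb R^2$ and some symmetric positive definite matrix $A$; respectively, if and only if $\Omega$ is an open ball of positive radius when $n\ge3$. -/

import Mathlib

open Filter Topology

/-- The `k`-th elementary symmetric function `σ_k(W)` of the eigenvalues of a square matrix, as a
polynomial in the entries of `W`: the sum of all principal `k × k` minors
(see `sigma_eq_esymm_eigenvalues`). -/
noncomputable def sigma {n : ℕ} (k : ℕ) (W : Matrix (Fin n) (Fin n) ℝ) : ℝ :=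
  ∑ s ∈ (Finset.univ : Finset (Fin n)).powersetCard k,
    (W.submatrix (Subtype.val : s → Fin n) (Subtype.val : s → Fin n)).det

/-- On symmetric matrices, `sigma k` is the `k`-th elementary symmetric function
`∑_{i₁ < ⋯ < i_k} λ_{i₁} ⋯ λ_{i_k}` of the eigenvalues. -/
theorem sigma_eq_esymm_eigenvalues {n : ℕ} (k : ℕ) (W : Matrix (Fin n) (Fin n) ℝ)
    (hW : W.IsHermitian) :
    sigma k W = ∑ s ∈ (Finset.univ : Finset (Fin n)).powersetCard k,
      ∏ i ∈ s, hW.eigenvalues i := by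
  rcases le_or_gt k n with hk | hk
  · have h1 := W.charpoly_coeff_eq_sum_minors k (by simpa using hk)
    have hd : W.charpoly.natDegree = n := by simp
    have h2 := Polynomial.coeff_eq_esymm_roots_of_splits hW.splits_charpoly
      (k := n - k) (by rw [hd]; exact Nat.sub_le _ _)
    rw [hd, Nat.sub_sub_self hk, W.charpoly_monic.leadingCoeff, one_mul,
      hW.roots_charpoly_eq_eigenvalues] at h2
    rw [Fintype.card_fin, h2] at h1
    have h3 := mul_left_cancel₀ (pow_ne_zero k (by norm_num : (-1 : ℝ) ≠ 0)) h1
    rw [Finset.esymm_map_val] at h3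
    exact h3.symm
  · have h0 : (Finset.univ : Finset (Fin n)).powersetCard k = ∅ :=
      Finset.powersetCard_eq_empty.mpr (by simpa using hk)
    simp [sigma, h0]

/-- `∂σ_k(W)/∂w_{pq}`, the `n²` entries of the matrix being independent variables. -/
noncomputable def dsigma {n : ℕ} (k : ℕ) (W : Matrix (Fin n) (Fin n) ℝ) (p q : Fin n) : ℝ :=
  lineDeriv ℝ (sigma k) W (Matrix.single p q 1)

/-- The partial derivative `u_i = ∂u/∂x_i`. -/
noncomputable def partialD {n : ℕ} (i : Fin n) (u : EuclideanSpace ℝ (Fin n) → ℝ)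
    (x : EuclideanSpace ℝ (Fin n)) : ℝ :=
  fderiv ℝ u x (EuclideanSpace.single i 1)

/-- The Hessian matrix `D²u(x) = (u_{ij}(x))`. -/
noncomputable def hessian {n : ℕ} (u : EuclideanSpace ℝ (Fin n) → ℝ)
    (x : EuclideanSpace ℝ (Fin n)) : Matrix (Fin n) (Fin n) ℝ :=
  Matrix.of fun i j => partialD j (partialD i u) x

/-- `ψ = ∑_{k,l} (∂σ₂(D²u)/∂u_{kl}) u_k u_l - 2(n-1)u`. -/
noncomputable def psi {n : ℕ} (u : EuclideanSpace ℝ (Fin n) → ℝ)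
    (x : EuclideanSpace ℝ (Fin n)) : ℝ :=
  (∑ k, ∑ l, dsigma 2 (hessian u x) k l * partialD k u x * partialD l u x)
    - 2 * ((n : ℝ) - 1) * u x

/-- `u` is a classical strictly convex solution of `det D²u = 1` in `Ω`, `u = 0` on `∂Ω`,
four times continuously differentiable in `Ω` and continuous up to the boundary. -/
structure IsStrictlyConvexSolution {n : ℕ} (Ω : Set (EuclideanSpace ℝ (Fin n)))
    (u : EuclideanSpace ℝ (Fin n) → ℝ) : Prop where
  contDiffOn : ContDiffOn ℝ 4 u Ω
  continuousOn : ContinuousOn u (closure Ω)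
  strictConvexOn : StrictConvexOn ℝ Ω u
  det_hessian : ∀ x ∈ Ω, (hessian u x).det = 1
  boundary : ∀ x ∈ frontier Ω, u x = 0

/-- `Ω` is a (solid, open) ellipsoid: `{x | (x - c)ᵀ A (x - c) < 1}` with `A` symmetric and
positive definite. For `n = 2` this is an ellipse. -/
def IsEllipsoid {n : ℕ} (Ω : Set (EuclideanSpace ℝ (Fin n))) : Prop :=
  ∃ (c : EuclideanSpace ℝ (Fin n)) (A : Matrix (Fin n) (Fin n) ℝ), A.PosDef ∧
    Ω = {x | (x - c).ofLp ⬝ᵥ A.mulVec (x - c).ofLp < 1}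

/-- `Ω` is an open ball of positive radius. -/
def IsBall {n : ℕ} (Ω : Set (EuclideanSpace ℝ (Fin n))) : Prop :=
  ∃ (c : EuclideanSpace ℝ (Fin n)) (r : ℝ), 0 < r ∧ Ω = Metric.ball c r

/-! ### Coordinate calculus for partial derivatives, Hessians and second-order operators -/

section Calculus

variable {n : ℕ} {f g : EuclideanSpace ℝ (Fin n) → ℝ} {x : EuclideanSpace ℝ (Fin n)}

/-! The function `ψ` is a subsolution of the linearized equation. Put `A = adj D²u`, which is the
inverse of `D²u` because `det D²u = 1`, and `L = ∑ A i j ∂_i ∂_j`. Differentiating `det D²u = 1`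
once gives `L u_k = 0`; differentiating it twice gives `L u_{kl} = tr (A T_k A T_l)`, where `T_k` is
the `k`-th derivative of `D²u`. Also `L u = n`. In `L ψ` the terms linear in third derivatives
cancel (`ellipticOp_psi`), and two nonnegative pieces remain.

The cubic piece is half the sum over `k, l` of `tr (A S A S)` with `S = u_k T_l - u_l T_k`, hence a
sum of squares (`Matrix.PosDef.sum_trace_sub`). The other piece is `2 (2 σ₂(D²u) - n (n - 1))`,
nonnegative by Maclaurin's inequality. So `L ψ ≥ 0`, and the strong maximum principle, proved here
through a Hopf barrier, makes `ψ` constant as soon as it has an interior maximum. Otherwise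
compactness of `closure Ω` forces the supremum to be approached at the boundary.

If `ψ` is constant, both pieces vanish. For `n ≥ 3`, equality in Maclaurin gives `D²u = 1`. For `n =
2` that equality carries no information, but where `∇u ≠ 0` the vanishing cubic piece makes the
third-derivative tensor a multiple of `∇u ⊗ ∇u ⊗ ∇u`. This tensor is trace-free with respect to `A`,
so it is zero, and `D²u` is constant. In either case `u` is a quadratic polynomial and `Ω` is one of
its sublevel sets. Conversely, on an ellipse or a ball the comparison principle identifies `u` with
the explicit quadratic solution, for which `ψ` is constant. -/

theorem ContDiffAt.partialD {m k : ℕ} (hf : ContDiffAt ℝ m f x) (hk : k + 1 ≤ m) (i : Fin n) :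
    ContDiffAt ℝ k (partialD i f) x := by
  have h : ContDiffAt ℝ k (fderiv ℝ f) x := hf.fderiv_right (by exact_mod_cast hk)
  exact h.clm_apply contDiffAt_const

theorem partialD_congr (h : f =ᶠ[𝓝 x] g) (i : Fin n) : partialD i f x = partialD i g x := by
  simp only [partialD, h.fderiv_eq]

theorem partialD_eventuallyEq (h : f =ᶠ[𝓝 x] g) (i : Fin n) :
    partialD i f =ᶠ[𝓝 x] partialD i g :=
  h.eventually_nhds.mono fun _ hy => partialD_congr hy i

theorem hessian_congr (h : f =ᶠ[𝓝 x] g) : hessian f x = hessian g x := by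
  ext i j
  exact partialD_congr (partialD_eventuallyEq h i) j

theorem partialD_const (c : ℝ) (i : Fin n) : partialD i (fun _ => c) x = 0 := by
  simp [partialD]

theorem partialD_add (hf : DifferentiableAt ℝ f x) (hg : DifferentiableAt ℝ g x) (i : Fin n) :
    partialD i (fun y => f y + g y) x = partialD i f x + partialD i g x := by
  simp [partialD, fderiv_fun_add hf hg]

theorem partialD_sub (hf : DifferentiableAt ℝ f x) (hg : DifferentiableAt ℝ g x) (i : Fin n) :
    partialD i (fun y => f y - g y) x = partialD i f x - partialD i g x := by
  simp [partialD, fderiv_fun_sub hf hg]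

theorem partialD_const_mul (hf : DifferentiableAt ℝ f x) (c : ℝ) (i : Fin n) :
    partialD i (fun y => c * f y) x = c * partialD i f x := by
  simp [partialD, fderiv_const_mul hf]

theorem partialD_mul (hf : DifferentiableAt ℝ f x) (hg : DifferentiableAt ℝ g x) (i : Fin n) :
    partialD i (fun y => f y * g y) x = f x * partialD i g x + partialD i f x * g x := by
  simp [partialD, fderiv_fun_mul hf hg, mul_comm]

theorem partialD_sum {ι : Type*} {s : Finset ι} {F : ι → EuclideanSpace ℝ (Fin n) → ℝ}
    (hF : ∀ a ∈ s, DifferentiableAt ℝ (F a) x) (i : Fin n) :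
    partialD i (fun y => ∑ a ∈ s, F a y) x = ∑ a ∈ s, partialD i (F a) x := by
  simp [partialD, fderiv_fun_sum hF]

theorem fderiv_apply_eq_sum (v : EuclideanSpace ℝ (Fin n)) :
    fderiv ℝ f x v = ∑ i, v i * partialD i f x := by
  have hv : v = ∑ i, v i • EuclideanSpace.single i (1 : ℝ) := by
    ext j; simp [Finset.sum_apply, Pi.single_apply]
  conv_lhs => rw [hv]
  simp [partialD]

theorem DifferentiableAt.hasDerivAt_line {y v : EuclideanSpace ℝ (Fin n)} {t : ℝ}
    (hf : DifferentiableAt ℝ f (y + t • v)) :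
    HasDerivAt (fun s : ℝ => f (y + s • v)) (∑ i, v i * partialD i f (y + t • v)) t := by
  rw [← fderiv_apply_eq_sum]
  have h : HasDerivAt (fun s : ℝ => y + s • v) v t := by
    simpa using ((hasDerivAt_id t).smul_const v).const_add y
  exact hf.hasFDerivAt.comp_hasDerivAt t h

theorem ContDiffAt.eventually_differentiableAt {m : ℕ} (hf : ContDiffAt ℝ m f x) (hm : 1 ≤ m) :
    ∀ᶠ y in 𝓝 x, DifferentiableAt ℝ f y := by
  have h1 : ContDiffAt ℝ (1 : ℕ) f x := hf.of_le (by exact_mod_cast hm)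
  exact (h1.eventually (by simp)).mono fun y hy => hy.differentiableAt (by simp)

theorem ContDiffAt.differentiableAt_nat {m : ℕ} (hf : ContDiffAt ℝ m f x) (hm : 1 ≤ m) :
    DifferentiableAt ℝ f x :=
  (hf.eventually_differentiableAt hm).self_of_nhds

theorem partialD_comm {m : ℕ} (hf : ContDiffAt ℝ m f x) (hm : 2 ≤ m) (i j : Fin n) :
    partialD j (partialD i f) x = partialD i (partialD j f) x := by
  have hf2 : ContDiffAt ℝ (2 : ℕ) f x := hf.of_le (by exact_mod_cast hm)
  have hs : IsSymmSndFDerivAt ℝ f x := hf2.isSymmSndFDerivAt (by simp)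
  have hd : DifferentiableAt ℝ (fderiv ℝ f) x :=
    (hf2.fderiv_right (m := 1) (by norm_num)).differentiableAt (by simp)
  have key : ∀ a b : Fin n, partialD b (partialD a f) x =
      fderiv ℝ (fderiv ℝ f) x (EuclideanSpace.single b 1) (EuclideanSpace.single a 1) := by
    intro a b
    have : partialD a f = fun y => fderiv ℝ f y (EuclideanSpace.single a 1) := rfl
    rw [this, partialD, fderiv_clm_apply hd (differentiableAt_const _)]
    simp
  rw [key, key, hs.eq]

theorem hessian_isSymm {m : ℕ} (hf : ContDiffAt ℝ m f x) (hm : 2 ≤ m) : (hessian f x).IsSymm := by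
  ext i j
  exact partialD_comm hf hm j i

theorem hessian_add (hf : ContDiffAt ℝ (2 : ℕ) f x) (hg : ContDiffAt ℝ (2 : ℕ) g x) :
    hessian (fun y => f y + g y) x = hessian f x + hessian g x := by
  ext i j
  have h : partialD i (fun y => f y + g y) =ᶠ[𝓝 x] fun y => partialD i f y + partialD i g y := by
    filter_upwards [hf.eventually_differentiableAt (by simp),
      hg.eventually_differentiableAt (by simp)] with y h1 h2
    exact partialD_add h1 h2 i
  simp only [hessian, Matrix.of_apply, Matrix.add_apply]
  rw [partialD_congr h, partialD_add ((hf.partialD (k := 1) le_rfl i).differentiableAt_nat le_rfl)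
    ((hg.partialD (k := 1) le_rfl i).differentiableAt_nat le_rfl)]

theorem hessian_const_mul (hf : ContDiffAt ℝ (2 : ℕ) f x) (c : ℝ) :
    hessian (fun y => c * f y) x = c • hessian f x := by
  ext i j
  have h : partialD i (fun y => c * f y) =ᶠ[𝓝 x] fun y => c * partialD i f y := by
    filter_upwards [hf.eventually_differentiableAt (by simp)] with y h1
    exact partialD_const_mul h1 c i
  simp only [hessian, Matrix.of_apply, Matrix.smul_apply, smul_eq_mul]
  rw [partialD_congr h, partialD_const_mul
    ((hf.partialD (k := 1) le_rfl i).differentiableAt_nat le_rfl)]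

theorem hessian_sub (hf : ContDiffAt ℝ (2 : ℕ) f x) (hg : ContDiffAt ℝ (2 : ℕ) g x) :
    hessian (fun y => f y - g y) x = hessian f x - hessian g x := by
  have h := hessian_add hf (contDiffAt_const.mul hg : ContDiffAt ℝ (2 : ℕ) (fun y => (-1) * g y) x)
  rw [hessian_const_mul hg] at h
  simpa [sub_eq_add_neg] using h

theorem hessian_sum {ι : Type*} {s : Finset ι} {F : ι → EuclideanSpace ℝ (Fin n) → ℝ}
    (hF : ∀ a ∈ s, ContDiffAt ℝ (2 : ℕ) (F a) x) :
    hessian (fun y => ∑ a ∈ s, F a y) x = ∑ a ∈ s, hessian (F a) x := by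
  classical
  induction s using Finset.induction_on with
  | empty =>
    have h : ∀ i : Fin n, partialD i (fun _ : EuclideanSpace ℝ (Fin n) => (0 : ℝ)) = fun _ => 0 :=
      fun i => funext fun y => partialD_const 0 i
    ext i j
    simp [hessian, h]
  | insert a s ha ih =>
    simp only [Finset.sum_insert ha]
    rw [hessian_add (hF a (by simp)) (ContDiffAt.sum fun b hb => hF b (by simp [hb])),
      ih fun b hb => hF b (by simp [hb])]

theorem hessian_mul (hf : ContDiffAt ℝ (2 : ℕ) f x) (hg : ContDiffAt ℝ (2 : ℕ) g x)
    (i j : Fin n) :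
    hessian (fun y => f y * g y) x i j = f x * hessian g x i j + hessian f x i j * g x +
      partialD i f x * partialD j g x + partialD j f x * partialD i g x := by
  have h : partialD i (fun y => f y * g y) =ᶠ[𝓝 x]
      fun y => f y * partialD i g y + partialD i f y * g y := by
    filter_upwards [hf.eventually_differentiableAt (by simp),
      hg.eventually_differentiableAt (by simp)] with y h1 h2
    exact partialD_mul h1 h2 i
  have df := hf.differentiableAt_nat (by simp)
  have dg := hg.differentiableAt_nat (by simp)
  have dfi := (hf.partialD (k := 1) le_rfl i).differentiableAt_nat le_rfl
  have dgi := (hg.partialD (k := 1) le_rfl i).differentiableAt_nat le_rfl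
  simp only [hessian, Matrix.of_apply]
  rw [partialD_congr h, partialD_add (df.fun_mul dgi) (dfi.fun_mul dg), partialD_mul df dgi,
    partialD_mul dfi dg]
  ring

/-- The operator `∑ A i j ∂_i ∂_j` with frozen coefficients. -/
noncomputable def ellipticOp (A : Matrix (Fin n) (Fin n) ℝ) (f : EuclideanSpace ℝ (Fin n) → ℝ)
    (x : EuclideanSpace ℝ (Fin n)) : ℝ :=
  ∑ i, ∑ j, A i j * hessian f x i j

/-- The bilinear form `∑ A i j ∂_i f ∂_j g`. -/
noncomputable def gradForm (A : Matrix (Fin n) (Fin n) ℝ) (f g : EuclideanSpace ℝ (Fin n) → ℝ)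
    (x : EuclideanSpace ℝ (Fin n)) : ℝ :=
  ∑ i, ∑ j, A i j * (partialD i f x * partialD j g x)

variable {A : Matrix (Fin n) (Fin n) ℝ}

theorem ellipticOp_add (hf : ContDiffAt ℝ (2 : ℕ) f x) (hg : ContDiffAt ℝ (2 : ℕ) g x) :
    ellipticOp A (fun y => f y + g y) x = ellipticOp A f x + ellipticOp A g x := by
  simp [ellipticOp, hessian_add hf hg, mul_add, Finset.sum_add_distrib]

theorem ellipticOp_sub (hf : ContDiffAt ℝ (2 : ℕ) f x) (hg : ContDiffAt ℝ (2 : ℕ) g x) :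
    ellipticOp A (fun y => f y - g y) x = ellipticOp A f x - ellipticOp A g x := by
  simp [ellipticOp, hessian_sub hf hg, mul_sub, Finset.sum_sub_distrib]

theorem ellipticOp_const_mul (hf : ContDiffAt ℝ (2 : ℕ) f x) (c : ℝ) :
    ellipticOp A (fun y => c * f y) x = c * ellipticOp A f x := by
  simp only [ellipticOp, hessian_const_mul hf, Finset.mul_sum, Matrix.smul_apply, smul_eq_mul]
  exact Finset.sum_congr rfl fun i _ => Finset.sum_congr rfl fun j _ => by ring

theorem ellipticOp_sum {ι : Type*} {s : Finset ι} {F : ι → EuclideanSpace ℝ (Fin n) → ℝ}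
    (hF : ∀ a ∈ s, ContDiffAt ℝ (2 : ℕ) (F a) x) :
    ellipticOp A (fun y => ∑ a ∈ s, F a y) x = ∑ a ∈ s, ellipticOp A (F a) x := by
  simp only [ellipticOp, hessian_sum hF, Matrix.sum_apply, Finset.mul_sum]
  symm
  rw [Finset.sum_comm]
  exact Finset.sum_congr rfl fun i _ => Finset.sum_comm

theorem ellipticOp_mul (hA : A.IsSymm) (hf : ContDiffAt ℝ (2 : ℕ) f x)
    (hg : ContDiffAt ℝ (2 : ℕ) g x) :
    ellipticOp A (fun y => f y * g y) x =
      f x * ellipticOp A g x + ellipticOp A f x * g x + 2 * gradForm A f g x := by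
  have hsw : gradForm A f g x = ∑ i, ∑ j, A i j * (partialD j f x * partialD i g x) := by
    rw [gradForm, Finset.sum_comm]
    refine Finset.sum_congr rfl fun i _ => Finset.sum_congr rfl fun j _ => ?_
    rw [hA.apply i j]
  rw [two_mul]
  nth_rw 2 [hsw]
  simp only [ellipticOp, gradForm, hessian_mul hf hg, Finset.mul_sum, Finset.sum_mul,
    ← Finset.sum_add_distrib]
  exact Finset.sum_congr rfl fun i _ => Finset.sum_congr rfl fun j _ => by ring

end Calculus

/-! ### Jacobi's formula and regularity of adjugates -/

section Determinant

variable {n : ℕ} {x : EuclideanSpace ℝ (Fin n)}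

/-- The product rule on the Leibniz expansion differentiates one column at a time; by Cramer's rule
each determinant with a replaced column is a diagonal entry of `adj M * M'`. -/
theorem hasDerivAt_det {M : ℝ → Matrix (Fin n) (Fin n) ℝ} {M' : Matrix (Fin n) (Fin n) ℝ} {t : ℝ}
    (h : ∀ i j, HasDerivAt (fun s => M s i j) (M' i j) t) :
    HasDerivAt (fun s => (M s).det) ((M t).adjugate * M').trace t := by
  have h1 : HasDerivAt (fun s => ∑ σ : Equiv.Perm (Fin n), (Equiv.Perm.sign σ : ℤ) *
      ∏ i, M s (σ i) i) (∑ σ : Equiv.Perm (Fin n), ((Equiv.Perm.sign σ : ℤ) : ℝ) *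
      ∑ i, (∏ j ∈ Finset.univ.erase i, M t (σ j) j) • M' (σ i) i) t :=
    HasDerivAt.fun_sum fun σ _ => (HasDerivAt.fun_finsetProd fun i _ => h (σ i) i).const_mul _
  simp only [Matrix.det_apply']
  convert h1 using 1
  have h2 : ∀ i, ((M t).adjugate * M') i i = ((M t).updateCol i fun a => M' a i).det := by
    intro i
    rw [← Matrix.cramer_apply, Matrix.cramer_eq_adjugate_mulVec]
    rfl
  simp only [Matrix.trace, Matrix.diag, h2, Matrix.det_apply', Finset.mul_sum]
  rw [Finset.sum_comm]
  refine Finset.sum_congr rfl fun σ _ => Finset.sum_congr rfl fun i _ => ?_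
  rw [← Finset.mul_prod_erase _ _ (Finset.mem_univ i)]
  simp only [Matrix.updateCol_self, smul_eq_mul]
  rw [Finset.prod_congr rfl fun j hj => Matrix.updateCol_ne (Finset.ne_of_mem_erase hj)]
  ring

theorem contDiffAt_det {k : ℕ} {M : EuclideanSpace ℝ (Fin n) → Matrix (Fin n) (Fin n) ℝ}
    (h : ∀ i j, ContDiffAt ℝ k (fun y => M y i j) x) :
    ContDiffAt ℝ k (fun y => (M y).det) x := by
  simp only [Matrix.det_apply']
  exact ContDiffAt.sum fun σ _ => contDiffAt_const.mul (contDiffAt_prod fun i _ => h _ _)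

theorem contDiffAt_adjugate {k : ℕ} {M : EuclideanSpace ℝ (Fin n) → Matrix (Fin n) (Fin n) ℝ}
    (h : ∀ i j, ContDiffAt ℝ k (fun y => M y i j) x) (i j : Fin n) :
    ContDiffAt ℝ k (fun y => (M y).adjugate i j) x := by
  simp only [Matrix.adjugate_apply]
  refine contDiffAt_det fun a b => ?_
  by_cases hab : a = j
  · subst hab
    simpa using contDiffAt_const
  · simpa [Matrix.updateRow_ne hab] using h a b

theorem partialD_det {M : EuclideanSpace ℝ (Fin n) → Matrix (Fin n) (Fin n) ℝ}
    (h : ∀ i j, ContDiffAt ℝ (1 : ℕ) (fun y => M y i j) x) (k : Fin n) :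
    partialD k (fun y => (M y).det) x =
      ∑ i, ∑ j, (M x).adjugate i j * partialD k (fun y => M y j i) x := by
  have line : ∀ f : EuclideanSpace ℝ (Fin n) → ℝ, ContDiffAt ℝ (1 : ℕ) f x →
      HasDerivAt (fun s : ℝ => f (x + s • EuclideanSpace.single k 1)) (partialD k f x) 0 := by
    intro f hf
    have hd : DifferentiableAt ℝ f (x + (0 : ℝ) • EuclideanSpace.single k 1) := by
      simpa using hf.differentiableAt_nat le_rfl
    simpa [Pi.single_apply] using hd.hasDerivAt_line
  have h1 := hasDerivAt_det (M := fun s => M (x + s • EuclideanSpace.single k 1))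
    (M' := Matrix.of fun i j => partialD k (fun y => M y i j) x) (t := 0)
    fun i j => line _ (h i j)
  rw [(line _ (contDiffAt_det h)).unique h1]
  simp [Matrix.trace, Matrix.mul_apply]

end Determinant

/-! ### Differentiating the equation `det D²u = 1` once and twice -/

section MongeAmpere

variable {n : ℕ} {u : EuclideanSpace ℝ (Fin n) → ℝ} {x : EuclideanSpace ℝ (Fin n)}

/-- The derivative of the Hessian matrix in the direction of the `k`-th axis. -/
noncomputable def thirdD (u : EuclideanSpace ℝ (Fin n) → ℝ) (x : EuclideanSpace ℝ (Fin n))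
    (k : Fin n) : Matrix (Fin n) (Fin n) ℝ :=
  Matrix.of fun i j => partialD k (fun y => hessian u y i j) x

theorem contDiffAt_hessian {m k : ℕ} (hu : ContDiffAt ℝ m u x) (hk : k + 2 ≤ m) (i j : Fin n) :
    ContDiffAt ℝ k (fun y => hessian u y i j) x :=
  (hu.partialD (k := k + 1) (by omega) i).partialD le_rfl j

theorem ContDiffAt.eventually_nat {m : ℕ} (hu : ContDiffAt ℝ m u x) :
    ∀ᶠ y in 𝓝 x, ContDiffAt ℝ m u y :=
  hu.eventually (by simp)

theorem thirdD_swap (hu : ContDiffAt ℝ (3 : ℕ) u x) (i j k : Fin n) :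
    thirdD u x k i j = thirdD u x k j i := by
  refine partialD_congr ?_ k
  filter_upwards [hu.eventually_nat] with y hy
  exact partialD_comm hy (by norm_num) i j

theorem thirdD_rotate (hu : ContDiffAt ℝ (3 : ℕ) u x) (i j k : Fin n) :
    thirdD u x k i j = thirdD u x j i k :=
  partialD_comm (hu.partialD (k := 2) (by norm_num) i) le_rfl j k

theorem hessian_partialD (hu : ContDiffAt ℝ (3 : ℕ) u x) (i j k : Fin n) :
    hessian (partialD k u) x i j = thirdD u x k i j := by
  have h : hessian (partialD k u) x i j = thirdD u x j k i := rfl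
  rw [h, thirdD_swap hu, ← thirdD_rotate hu]

/-- Symmetry of fourth derivatives, arranged so that differentiating `∑ A i j u_{ijk} = 0` in
direction `l` produces exactly `L u_{kl}`. -/
theorem hessian_hessian (hu : ContDiffAt ℝ (4 : ℕ) u x) (i j k l : Fin n) :
    hessian (fun y => hessian u y k l) x i j =
      partialD l (fun y => thirdD u y k i j) x := by
  have h0 : hessian (fun y => hessian u y k l) x i j =
    partialD j (fun y => thirdD u y i k l) x := rfl
  have h1 : (fun y => thirdD u y i k l) =ᶠ[𝓝 x] fun y => thirdD u y l i k := by
    filter_upwards [(hu.of_le (by norm_num) : ContDiffAt ℝ (3 : ℕ) u x).eventually_nat] with y hy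
    rw [thirdD_rotate hy, thirdD_swap hy]
  have h2 : (fun y => thirdD u y j i k) =ᶠ[𝓝 x] fun y => thirdD u y k i j := by
    filter_upwards [(hu.of_le (by norm_num) : ContDiffAt ℝ (3 : ℕ) u x).eventually_nat] with y hy
    rw [thirdD_rotate hy]
  rw [h0, partialD_congr h1, ← partialD_congr h2]
  exact partialD_comm (contDiffAt_hessian (k := 2) hu le_rfl i k) le_rfl l j

/-- The first derivative of `det D²u = 1`, by Jacobi's formula: the third-derivative tensor is
trace-free with respect to `adj D²u`. -/
theorem partialD_hessian_trace (hu : ContDiffAt ℝ (3 : ℕ) u x)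
    (hdet : ∀ᶠ y in 𝓝 x, (hessian u y).det = 1) (k : Fin n) :
    ∑ i, ∑ j, (hessian u x).adjugate i j * thirdD u x k i j = 0 := by
  have h1 := partialD_det (M := fun y => hessian u y)
    (fun i j => contDiffAt_hessian (k := 1) hu le_rfl i j) k
  have h2 : partialD k (fun y => (hessian u y).det) x = 0 := by
    rw [partialD_congr (g := fun _ => 1) hdet, partialD_const]
  rw [h2] at h1
  rw [h1]
  exact Finset.sum_congr rfl fun i _ => Finset.sum_congr rfl fun j _ =>
    congrArg _ (thirdD_swap hu i j k)

theorem ellipticOp_partialD (hu : ContDiffAt ℝ (3 : ℕ) u x)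
    (hdet : ∀ᶠ y in 𝓝 x, (hessian u y).det = 1) (k : Fin n) :
    ellipticOp (hessian u x).adjugate (partialD k u) x = 0 := by
  rw [← partialD_hessian_trace hu hdet k]
  simp only [ellipticOp, hessian_partialD hu]

/-- Since the determinant is `1`, the adjugate is the inverse, and differentiating `adj D²u * D²u =
1` gives the usual formula for the derivative of an inverse. -/
theorem partialD_adjugate_hessian (hu : ContDiffAt ℝ (3 : ℕ) u x)
    (hdet : ∀ᶠ y in 𝓝 x, (hessian u y).det = 1) (l : Fin n) :
    (Matrix.of fun i j => partialD l (fun y => (hessian u y).adjugate i j) x) =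
      -((hessian u x).adjugate * thirdD u x l * (hessian u x).adjugate) := by
  set A := (hessian u x).adjugate
  set D := Matrix.of fun i j => partialD l (fun y => (hessian u y).adjugate i j) x with hD
  have hU := fun i j => contDiffAt_hessian (k := 1) hu le_rfl i j
  have hA := fun i j => contDiffAt_adjugate (M := fun y => hessian u y) hU i j
  have h1 : A * thirdD u x l + D * hessian u x = 0 := by
    ext i j
    have h2 : (fun y => ∑ m, (hessian u y).adjugate i m * hessian u y m j) =ᶠ[𝓝 x]
        fun _ => (1 : Matrix (Fin n) (Fin n) ℝ) i j := by
      filter_upwards [hdet] with y hy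
      rw [← Matrix.mul_apply, Matrix.adjugate_mul, hy, one_smul]
    have h3 := partialD_congr h2 l
    rw [partialD_const, partialD_sum fun m _ => ((hA i m).differentiableAt_nat le_rfl).fun_mul
      ((hU m j).differentiableAt_nat le_rfl)] at h3
    simp only [partialD_mul ((hA i _).differentiableAt_nat le_rfl)
      ((hU _ j).differentiableAt_nat le_rfl), Finset.sum_add_distrib] at h3
    simp only [Matrix.add_apply, Matrix.mul_apply, Matrix.zero_apply]
    exact h3
  have h4 : hessian u x * A = 1 := by
    rw [Matrix.mul_adjugate, hdet.self_of_nhds, one_smul]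
  calc D = D * hessian u x * A := by rw [Matrix.mul_assoc, h4, Matrix.mul_one]
    _ = -(A * thirdD u x l * A) := by rw [eq_neg_of_add_eq_zero_right h1, Matrix.neg_mul]

/-- The second derivative of the equation: differentiating the trace-free identity in direction `l`,
the fourth-order part is `L u_{kl}`, and the derivative of the coefficients supplies the quadratic
third-order term. -/
theorem ellipticOp_hessian (hu : ContDiffAt ℝ (4 : ℕ) u x)
    (hdet : ∀ᶠ y in 𝓝 x, (hessian u y).det = 1) (k l : Fin n) :
    ellipticOp (hessian u x).adjugate (fun y => hessian u y k l) x =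
      ((hessian u x).adjugate * thirdD u x k * (hessian u x).adjugate * thirdD u x l).trace := by
  have hu3 : ContDiffAt ℝ (3 : ℕ) u x := hu.of_le (by norm_num)
  have hT : ∀ i j, ContDiffAt ℝ (1 : ℕ) (fun y => thirdD u y k i j) x := fun i j =>
    (contDiffAt_hessian (k := 2) hu le_rfl i j).partialD le_rfl k
  have hA := fun i j => contDiffAt_adjugate (M := fun y => hessian u y)
    (fun a b => contDiffAt_hessian (k := 1) hu3 le_rfl a b) i j
  have h1 : (fun y => ∑ i, ∑ j, (hessian u y).adjugate i j * thirdD u y k i j) =ᶠ[𝓝 x]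
      fun _ => 0 := by
    filter_upwards [hu3.eventually_nat, hdet.eventually_nhds] with y hy hy'
    exact partialD_hessian_trace hy hy' k
  have hd := fun i j => ((hA i j).differentiableAt_nat le_rfl).fun_mul
    ((hT i j).differentiableAt_nat le_rfl)
  have h2 := partialD_congr h1 l
  rw [partialD_const, partialD_sum fun i _ => DifferentiableAt.fun_sum fun j _ => hd i j] at h2
  simp only [partialD_sum (fun j _ => hd _ j), partialD_mul
    ((hA _ _).differentiableAt_nat le_rfl) ((hT _ _).differentiableAt_nat le_rfl),
    Finset.sum_add_distrib] at h2
  have h3 : ellipticOp (hessian u x).adjugate (fun y => hessian u y k l) x =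
      -∑ i, ∑ j, partialD l (fun y => (hessian u y).adjugate i j) x * thirdD u x k i j := by
    rw [← eq_neg_of_add_eq_zero_left h2]
    simp only [ellipticOp, hessian_hessian hu]
  have h4 : ∀ i j, partialD l (fun y => (hessian u y).adjugate i j) x =
      (-((hessian u x).adjugate * thirdD u x l * (hessian u x).adjugate)) i j := fun i j =>
    congrFun (congrFun (partialD_adjugate_hessian hu3 hdet l) i) j
  rw [h3]
  simp only [h4, Matrix.neg_apply, neg_mul, Finset.sum_neg_distrib, neg_neg]
  have h5 : ((hessian u x).adjugate * thirdD u x k * (hessian u x).adjugate *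
      thirdD u x l).trace =
      ((hessian u x).adjugate * thirdD u x l * (hessian u x).adjugate * thirdD u x k).trace := by
    rw [Matrix.mul_assoc, Matrix.trace_mul_comm, ← Matrix.mul_assoc]
  rw [h5, Matrix.trace]
  simp only [Matrix.diag]
  refine Finset.sum_congr rfl fun i _ => ?_
  rw [Matrix.mul_apply]
  exact Finset.sum_congr rfl fun j _ => by rw [thirdD_swap hu3 i j k]

end MongeAmpere

/-! ### Explicit formulas for `σ₂`, its gradient and `ψ` -/

section SigmaTwo

variable {n : ℕ}

theorem sigma_two (W : Matrix (Fin n) (Fin n) ℝ) :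
    sigma 2 W = (W.trace ^ 2 - (W * W).trace) / 2 := by
  have key : ∀ i j : Fin n, i ≠ j →
      (W.submatrix (Subtype.val : ({i, j} : Finset (Fin n)) → Fin n) Subtype.val).det =
        W i i * W j j - W i j * W j i := by
    intro i j hij
    let e : Fin 2 → ({i, j} : Finset (Fin n)) := ![⟨i, by simp⟩, ⟨j, by simp⟩]
    have he : Function.Bijective e := by
      rw [Fintype.bijective_iff_injective_and_card]
      constructor
      · intro a b hab
        fin_cases a <;> fin_cases b <;> simp_all [e]
      · rw [Fintype.card_coe, Finset.card_pair hij, Fintype.card_fin]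
    rw [← Matrix.det_submatrix_equiv_self (Equiv.ofBijective e he), Matrix.det_fin_two]
    simp [e]
  -- Each two-element set is the image of two ordered pairs, whence the factor `2`.
  have h1 : ∑ p ∈ (Finset.univ : Finset (Fin n)).offDiag,
      (W p.1 p.1 * W p.2 p.2 - W p.1 p.2 * W p.2 p.1) = 2 * sigma 2 W := by
    have hmap : ∀ p ∈ (Finset.univ : Finset (Fin n)).offDiag,
        ({p.1, p.2} : Finset (Fin n)) ∈ (Finset.univ : Finset (Fin n)).powersetCard 2 := by
      intro p hp
      simp only [Finset.mem_offDiag] at hp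
      simp [Finset.mem_powersetCard, Finset.card_pair hp.2.2]
    rw [← Finset.sum_fiberwise_of_maps_to hmap, sigma, Finset.mul_sum]
    refine Finset.sum_congr rfl fun s hs => ?_
    obtain ⟨i, j, hij, rfl⟩ := Finset.card_eq_two.mp (Finset.mem_powersetCard.mp hs).2
    have hf : (Finset.univ : Finset (Fin n)).offDiag.filter
        (fun p => ({p.1, p.2} : Finset (Fin n)) = {i, j}) = {(i, j), (j, i)} := by
      ext ⟨a, b⟩
      simp only [Finset.mem_filter, Finset.mem_offDiag, Finset.mem_univ, true_and,
        Finset.mem_insert, Finset.mem_singleton, Prod.mk.injEq]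
      constructor
      · rintro ⟨hab, h⟩
        have ha : a ∈ ({i, j} : Finset (Fin n)) := h ▸ by simp
        have hb : b ∈ ({i, j} : Finset (Fin n)) := h ▸ by simp
        simp only [Finset.mem_insert, Finset.mem_singleton] at ha hb
        grind
      · rintro (⟨rfl, rfl⟩ | ⟨rfl, rfl⟩)
        · exact ⟨hij, rfl⟩
        · exact ⟨hij.symm, Finset.pair_comm _ _⟩
    rw [hf, Finset.sum_pair (by simp [hij]), key i j hij]
    ring
  have h2 : ∑ p ∈ (Finset.univ : Finset (Fin n)).offDiag,
      (W p.1 p.1 * W p.2 p.2 - W p.1 p.2 * W p.2 p.1) =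
      ∑ p ∈ (Finset.univ : Finset (Fin n)) ×ˢ Finset.univ,
      (W p.1 p.1 * W p.2 p.2 - W p.1 p.2 * W p.2 p.1) := by
    refine Finset.sum_subset (fun p _ => by simp) fun p _ hp => ?_
    have : p.1 = p.2 := by simpa using hp
    rw [this, sub_self]
  rw [h2, Finset.sum_product, eq_comm] at h1
  simp only [Finset.sum_sub_distrib] at h1
  have h3 : W.trace ^ 2 = ∑ i, ∑ j, W i i * W j j := by
    simp [Matrix.trace, sq, Finset.sum_mul_sum]
  have h4 : (W * W).trace = ∑ i, ∑ j, W i j * W j i := by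
    simp [Matrix.trace, Matrix.mul_apply]
  rw [h3, h4]
  linarith

/-- Along a line `σ₂` is a quadratic polynomial in the parameter, and the derivative at `0` is its
linear coefficient. With independent entries the transposed entry `W l k` appears. -/
theorem dsigma_two (W : Matrix (Fin n) (Fin n) ℝ) (k l : Fin n) :
    dsigma 2 W k l = (if k = l then W.trace else 0) - W l k := by
  have htr : (Matrix.single k l (1 : ℝ)).trace = if k = l then 1 else 0 := by
    split_ifs with h
    · subst h; simp
    · exact Matrix.trace_single_eq_of_ne _ _ _ h
  have hWE : (W * Matrix.single k l (1 : ℝ)).trace = W l k := by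
    simp [Matrix.trace_mul_single]
  have h : ∀ t : ℝ, sigma 2 (W + t • Matrix.single k l (1 : ℝ)) =
      sigma 2 W + t * ((if k = l then W.trace else 0) - W l k) +
        t ^ 2 * sigma 2 (Matrix.single k l (1 : ℝ)) := by
    intro t
    simp only [sigma_two, Matrix.trace_add, Matrix.trace_smul, Matrix.add_mul, Matrix.mul_add,
      Matrix.smul_mul, Matrix.mul_smul, Matrix.trace_mul_comm (Matrix.single k l (1 : ℝ)) W, htr,
      hWE, smul_eq_mul]
    split_ifs <;> ring
  unfold dsigma lineDeriv
  simp only [h]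
  set c := (if k = l then W.trace else 0) - W l k
  have hd : HasDerivAt (fun t : ℝ => sigma 2 W + t * c +
      t ^ 2 * sigma 2 (Matrix.single k l (1 : ℝ))) c 0 := by
    have := (((hasDerivAt_id (0 : ℝ)).mul_const c).const_add (sigma 2 W)).add
      (((hasDerivAt_id (0 : ℝ)).pow 2).mul_const (sigma 2 (Matrix.single k l (1 : ℝ))))
    refine this.congr_deriv ?_
    simp
  exact hd.deriv

theorem psi_eq (u : EuclideanSpace ℝ (Fin n) → ℝ) (x : EuclideanSpace ℝ (Fin n)) :
    psi u x = (∑ k, ∑ l, (hessian u x l l * (partialD k u x * partialD k u x) -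
      hessian u x l k * (partialD k u x * partialD l u x))) - 2 * ((n : ℝ) - 1) * u x := by
  simp only [psi, dsigma_two, sub_mul, Finset.sum_sub_distrib]
  congr 2
  · refine Finset.sum_congr rfl fun k _ => ?_
    rw [← Finset.sum_mul]
    simp [ite_mul, Matrix.trace, mul_assoc]
  · simp only [mul_assoc]

end SigmaTwo

/-! ### Arithmetic-geometric mean and Maclaurin inequalities for positive definite matrices -/

section PositiveDefinite

variable {n : ℕ} {A B : Matrix (Fin n) (Fin n) ℝ}

open scoped MatrixOrder in
theorem Matrix.PosSemidef.exists_eq_conjTranspose_mul_self (hA : A.PosSemidef) :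
    ∃ C : Matrix (Fin n) (Fin n) ℝ, A = C.conjTranspose * C :=
  ⟨CFC.sqrt A, by
    rw [(Matrix.nonneg_iff_posSemidef.mp (CFC.sqrt_nonneg A)).isHermitian.eq, CFC.sqrt_mul_sqrt_self A hA.nonneg]⟩

theorem Matrix.PosSemidef.trace_mul_nonneg (hA : A.PosSemidef) (hB : B.PosSemidef) :
    0 ≤ (A * B).trace := by
  obtain ⟨C, rfl⟩ := hA.exists_eq_conjTranspose_mul_self
  rw [Matrix.mul_assoc, Matrix.trace_mul_comm]
  exact (hB.mul_mul_conjTranspose_same C).trace_nonneg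

/-- Sum `log t ≤ t - 1` over the factors: the logarithms add up to `0`, and the inequality is strict
unless `t = 1`. -/
theorem card_le_sum_of_prod_eq_one {ι : Type*} {s : Finset ι} {f : ι → ℝ}
    (hf : ∀ i ∈ s, 0 < f i) (hp : ∏ i ∈ s, f i = 1) :
    (s.card : ℝ) ≤ ∑ i ∈ s, f i ∧ (∑ i ∈ s, f i = s.card → ∀ i ∈ s, f i = 1) := by
  have h0 : ∑ i ∈ s, Real.log (f i) = 0 := by
    rw [← Real.log_prod fun i hi => (hf i hi).ne', hp, Real.log_one]
  have h1 : ∀ i ∈ s, 0 ≤ f i - 1 - Real.log (f i) := fun i hi => by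
    linarith [Real.log_le_sub_one_of_pos (hf i hi)]
  have h2 : ∑ i ∈ s, (f i - 1 - Real.log (f i)) = ∑ i ∈ s, f i - s.card := by
    simp [Finset.sum_sub_distrib, h0]
  refine ⟨by linarith [Finset.sum_nonneg h1], fun he i hi => ?_⟩
  have h3 := (Finset.sum_eq_zero_iff_of_nonneg h1).mp (by rw [h2, he, sub_self]) i hi
  by_contra hne
  linarith [Real.log_lt_sub_one_of_pos (hf i hi) hne]

theorem Matrix.PosDef.le_trace_of_det_eq_one (hA : A.PosDef) (hdet : A.det = 1) :
    (n : ℝ) ≤ A.trace := by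
  have h := (card_le_sum_of_prod_eq_one (s := Finset.univ) (f := hA.isHermitian.eigenvalues)
    (fun i _ => hA.eigenvalues_pos i) (by
      rw [← hdet, hA.isHermitian.det_eq_prod_eigenvalues]; simp)).1
  rw [hA.isHermitian.trace_eq_sum_eigenvalues]
  simpa using h

/-- Writing `A = Cᵀ C` turns `tr (A B)` into the trace of the positive definite matrix `C B Cᵀ` of
determinant `1`, to which the arithmetic-geometric mean inequality applies. -/
theorem Matrix.PosDef.le_trace_mul_of_det_eq_one (hA : A.PosDef) (hB : B.PosDef)
    (hdA : A.det = 1) (hdB : B.det = 1) : (n : ℝ) ≤ (A * B).trace := by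
  obtain ⟨C, rfl⟩ := hA.posSemidef.exists_eq_conjTranspose_mul_self
  have h1 : (C * B * C.conjTranspose).det = 1 := by
    rw [Matrix.det_mul] at hdA
    rw [Matrix.det_mul, Matrix.det_mul, hdB, mul_one, mul_comm, hdA]
  have h2 : (C * B * C.conjTranspose).PosDef :=
    (hB.posSemidef.mul_mul_conjTranspose_same C).posDef_iff_det_ne_zero.mpr
      (by rw [h1]; exact one_ne_zero)
  rw [Matrix.mul_assoc, Matrix.trace_mul_comm]
  exact h2.le_trace_of_det_eq_one h1

/-- The Maclaurin inequality between `σ₂` and the determinant. -/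
theorem Matrix.PosDef.le_trace_sq_sub (hA : A.PosDef) (hdet : A.det = 1) :
    (n : ℝ) * (n - 1) ≤ A.trace ^ 2 - (A * A).trace ∧
      (A.trace ^ 2 - (A * A).trace = n * (n - 1) → 3 ≤ n → A = 1) := by
  set e := hA.isHermitian.eigenvalues with he
  have hpos : ∀ i, 0 < e i := hA.eigenvalues_pos
  have hprod : ∏ i, e i = 1 := by
    rw [← hdet, hA.isHermitian.det_eq_prod_eigenvalues]; simp [he]
  have htr : A.trace = ∑ i, e i := by
    rw [hA.isHermitian.trace_eq_sum_eigenvalues]; simp [he]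
  have htr2 : (A * A).trace = ∑ i, e i * e i := by
    conv_lhs => rw [hA.isHermitian.spectral_theorem, ← map_mul, Unitary.conjStarAlgAut_apply,
      Matrix.trace_mul_cycle, Unitary.coe_star_mul_self, one_mul, Matrix.diagonal_mul_diagonal,
      Matrix.trace_diagonal]
    simp [he]
  have hsum : ∑ p ∈ (Finset.univ : Finset (Fin n)).offDiag, e p.1 * e p.2 =
      A.trace ^ 2 - (A * A).trace := by
    have h1 := Finset.sum_union (Finset.disjoint_diag_offDiag (Finset.univ : Finset (Fin n)))
      (f := fun p => e p.1 * e p.2)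
    rw [Finset.diag_union_offDiag, Finset.sum_product, Finset.sum_diag] at h1
    rw [htr, htr2, sq, Finset.sum_mul_sum, h1]
    ring
  have hcard : (((Finset.univ : Finset (Fin n)).offDiag.card : ℕ) : ℝ) = n * (n - 1) := by
    rw [Finset.offDiag_card]
    simp only [Finset.card_univ, Fintype.card_fin]
    rw [Nat.cast_sub (Nat.le_mul_self n)]
    push_cast; ring
  -- The numbers `e i * e j` over ordered pairs with `i ≠ j` also have product `1`, so the
  -- arithmetic-geometric mean inequality for them is the Maclaurin inequality.
  have hoff : ∏ p ∈ (Finset.univ : Finset (Fin n)).offDiag, e p.1 * e p.2 = 1 := by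
    have h1 := Finset.prod_union (Finset.disjoint_diag_offDiag (Finset.univ : Finset (Fin n)))
      (f := fun p => e p.1 * e p.2)
    rw [Finset.diag_union_offDiag, Finset.prod_product, Finset.prod_diag] at h1
    have h2 : ∏ i, ∏ j, e i * e j = 1 := by
      simp [Finset.prod_mul_distrib, hprod, Finset.prod_pow]
    rw [h2, Finset.prod_mul_distrib, hprod, one_mul, one_mul] at h1
    exact h1.symm
  have h := card_le_sum_of_prod_eq_one (f := fun p : Fin n × Fin n => e p.1 * e p.2)
    (fun p _ => mul_pos (hpos p.1) (hpos p.2)) hoff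
  rw [hcard, hsum] at h
  refine ⟨h.1, fun heq hn => ?_⟩
  have h1 : ∀ i j, i ≠ j → e i * e j = 1 := fun i j hij => h.2 heq (i, j) (by simp [hij])
  -- A third index is what decides: pairwise products equal to `1` force all eigenvalues to agree.
  -- With only two indices one merely recovers `det A = 1`.
  have h2 : ∀ i, e i = 1 := by
    intro i
    obtain ⟨j, hj⟩ := Fintype.exists_ne_of_one_lt_card (by simp; omega) i
    obtain ⟨k, hki, hkj⟩ : ∃ k, k ≠ i ∧ k ≠ j := by
      have := Finset.exists_mem_notMem_of_card_lt_card (s := {i, j}) (t := Finset.univ)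
        (by rw [Finset.card_univ, Fintype.card_fin]; exact (Finset.card_le_two).trans_lt (by omega))
      simpa using this
    have a1 := h1 i j hj.symm
    have a2 := h1 i k hki.symm
    have a3 := h1 j k hkj.symm
    have a4 : e j = e k := mul_left_cancel₀ (hpos i).ne' (a1.trans a2.symm)
    rw [← a4] at a3
    have a5 : e j = 1 := by nlinarith [hpos j]
    rwa [a5, mul_one] at a1
  have h3 : e = 1 := funext h2
  have h4 := hA.isHermitian.spectral_theorem
  rw [← he, h3] at h4
  rw [h4]
  simp

end PositiveDefinite

/-! ### Algebra of the third-derivative tensor -/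

section TensorAlgebra

variable {n : ℕ} {A : Matrix (Fin n) (Fin n) ℝ}

/-- With `A = Cᵀ C` the trace is the squared Frobenius norm of `C S Cᵀ`. -/
theorem Matrix.PosDef.trace_mul_sq_nonneg (hA : A.PosDef) {S : Matrix (Fin n) (Fin n) ℝ}
    (hS : S.IsSymm) :
    0 ≤ (A * S * A * S).trace ∧ ((A * S * A * S).trace = 0 → S = 0) := by
  obtain ⟨C, hC⟩ := hA.posSemidef.exists_eq_conjTranspose_mul_self
  have hS' : S.conjTranspose = S := hS
  have h1 : (A * S * A * S).trace =
      ((C * S * C.conjTranspose).conjTranspose * (C * S * C.conjTranspose)).trace := by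
    have h2 : (C * S * C.conjTranspose).conjTranspose = C * S * C.conjTranspose := by
      rw [Matrix.conjTranspose_mul, Matrix.conjTranspose_mul, Matrix.conjTranspose_conjTranspose,
        hS', Matrix.mul_assoc]
    rw [h2, hC, show C.conjTranspose * C * S * (C.conjTranspose * C) * S =
      C.conjTranspose * (C * S * C.conjTranspose * C * S) by simp only [Matrix.mul_assoc],
      Matrix.trace_mul_comm]
    simp only [Matrix.mul_assoc]
  refine ⟨h1 ▸ (Matrix.posSemidef_conjTranspose_mul_self _).trace_nonneg, fun h0 => ?_⟩
  rw [h1, Matrix.trace_conjTranspose_mul_self_eq_zero_iff] at h0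
  have h3 : A * S * A = 0 := by
    calc A * S * A = C.conjTranspose * (C * S * C.conjTranspose) * C := by
          rw [hC]; simp only [Matrix.mul_assoc]
      _ = 0 := by rw [h0]; simp
  have hu := hA.isUnit
  exact hu.mul_left_eq_zero.mp (by
    rw [← hu.mul_right_eq_zero, ← Matrix.mul_assoc, h3])

/-- A Lagrange identity: twice the sum equals the sum over `k, l` of `tr (A S A S)` with `S = p k •
T l - p l • T k`, and each of these terms is a squared norm. -/
theorem Matrix.PosDef.sum_trace_sub (hA : A.PosDef) {T : Fin n → Matrix (Fin n) (Fin n) ℝ}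
    (hT : ∀ k, (T k).IsSymm) (p : Fin n → ℝ) :
    0 ≤ ∑ k, ∑ l, ((A * T l * A * T l).trace * (p k * p k) -
      (A * T l * A * T k).trace * (p k * p l)) ∧
    (∑ k, ∑ l, ((A * T l * A * T l).trace * (p k * p k) -
      (A * T l * A * T k).trace * (p k * p l)) = 0 → ∀ k l, p k • T l = p l • T k) := by
  have hsymm : ∀ k l, (p k • T l - p l • T k).IsSymm := fun k l =>
    ((hT l).smul _).sub ((hT k).smul _)
  have hcomm : ∀ k l, (A * T l * A * T k).trace = (A * T k * A * T l).trace := fun k l => by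
    rw [Matrix.mul_assoc, Matrix.trace_mul_comm, ← Matrix.mul_assoc]
  have hexp : ∀ k l, (A * (p k • T l - p l • T k) * A * (p k • T l - p l • T k)).trace =
      ((A * T l * A * T l).trace * (p k * p k) - (A * T l * A * T k).trace * (p k * p l)) +
      ((A * T k * A * T k).trace * (p l * p l) - (A * T k * A * T l).trace * (p l * p k)) := by
    intro k l
    simp only [Matrix.mul_sub, Matrix.sub_mul, Matrix.mul_smul, Matrix.smul_mul,
      Matrix.trace_sub, Matrix.trace_smul, smul_eq_mul]
    rw [hcomm k l]
    ring
  have hsum : ∑ k, ∑ l, (A * (p k • T l - p l • T k) * A * (p k • T l - p l • T k)).trace =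
      2 * ∑ k, ∑ l, ((A * T l * A * T l).trace * (p k * p k) -
      (A * T l * A * T k).trace * (p k * p l)) := by
    simp only [hexp]
    simp only [Finset.sum_add_distrib]
    rw [two_mul]
    congr 1
    exact Finset.sum_comm
  have hnn : ∀ k l, 0 ≤ (A * (p k • T l - p l • T k) * A * (p k • T l - p l • T k)).trace :=
    fun k l => (hA.trace_mul_sq_nonneg (hsymm k l)).1
  refine ⟨?_, fun h0 k l => ?_⟩
  · have := Finset.sum_nonneg fun k (_ : k ∈ Finset.univ) =>
      Finset.sum_nonneg fun l (_ : l ∈ Finset.univ) => hnn k l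
    rw [hsum] at this
    linarith
  · rw [h0, mul_zero] at hsum
    have h1 := (Finset.sum_eq_zero_iff_of_nonneg fun k _ =>
      Finset.sum_nonneg fun l (_ : l ∈ Finset.univ) => hnn k l).mp hsum k (Finset.mem_univ k)
    have h2 := (Finset.sum_eq_zero_iff_of_nonneg fun l _ => hnn k l).mp h1 l (Finset.mem_univ l)
    exact sub_eq_zero.mp ((hA.trace_mul_sq_nonneg (hsymm k l)).2 h2)

/-- A totally symmetric 3-tensor all of whose slices are parallel to `p` is a multiple of
`p ⊗ p ⊗ p`, so it vanishes if it is trace-free with respect to a positive definite form. -/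
theorem Matrix.PosDef.tensor_eq_zero (hA : A.PosDef) {T : Fin n → Matrix (Fin n) (Fin n) ℝ}
    (hT : ∀ k, (T k).IsSymm) (hrot : ∀ i j k, T k i j = T j i k)
    (htr : ∀ k, ∑ i, ∑ j, A i j * T k i j = 0) {p : Fin n → ℝ} (hp : p ≠ 0)
    (hpar : ∀ k l, p k • T l = p l • T k) (k : Fin n) : T k = 0 := by
  have hpar' : ∀ k l i j, p k * T l i j = p l * T k i j := fun k l i j =>
    congrFun (congrFun (hpar k l) i) j
  have hsw : ∀ k i j, T k i j = T k j i := fun k i j => (hT k).apply j i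
  obtain ⟨a, ha⟩ : ∃ a, p a ≠ 0 := by
    by_contra! h
    exact hp (funext h)
  set t := T a a a / p a ^ 3 with ht
  -- Total symmetry lets each of the three indices in turn be moved to `a`, where `p a ≠ 0`, at the
  -- cost of a factor `p k / p a`, `p j / p a` or `p i / p a`.
  have hform : ∀ k i j, T k i j = t * (p k * (p i * p j)) := by
    intro k i j
    have h1 : p a * T k i j = p k * T a i j := hpar' a k i j
    have h2 : p a * T a i j = p j * T a i a := by
      rw [hrot i j a, hpar' a j i a]
    have h3 : p a * T a i a = p i * T a a a := by
      rw [hsw a i a, hrot a i a, hpar' a i a a]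
    rw [ht]
    field_simp
    linear_combination p a ^ 2 * h1 + p a * p k * h2 + p k * p j * h3
  have hq : 0 < ∑ i, ∑ j, A i j * (p i * p j) := by
    have h := hA.dotProduct_mulVec_pos hp
    refine h.trans_eq ?_
    simp only [dotProduct, Matrix.mulVec, Pi.star_apply, star_trivial, Finset.mul_sum]
    exact Finset.sum_congr rfl fun i _ => Finset.sum_congr rfl fun j _ => by ring
  have ht0 : t = 0 := by
    have h := htr a
    simp only [hform] at h
    have h' : ∑ i, ∑ j, A i j * (t * (p a * (p i * p j))) =
        t * p a * ∑ i, ∑ j, A i j * (p i * p j) := by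
      simp only [Finset.mul_sum]
      exact Finset.sum_congr rfl fun i _ => Finset.sum_congr rfl fun j _ => by ring
    rw [h'] at h
    simpa [ha, hq.ne'] using h
  ext i j
  rw [hform, ht0, zero_mul, Matrix.zero_apply]

end TensorAlgebra

/-! ### The differential inequality `L ψ ≥ 0` and its equality case -/

section DifferentialInequality

variable {n : ℕ} {u : EuclideanSpace ℝ (Fin n) → ℝ} {x : EuclideanSpace ℝ (Fin n)}

theorem contDiffAt_psi (hu : ContDiffAt ℝ (4 : ℕ) u x) : ContDiffAt ℝ (2 : ℕ) (psi u) x := by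
  have hp : ∀ k, ContDiffAt ℝ (2 : ℕ) (partialD k u) x := fun k => hu.partialD (by norm_num) k
  have hU : ∀ k l, ContDiffAt ℝ (2 : ℕ) (fun y => hessian u y k l) x :=
    contDiffAt_hessian hu le_rfl
  rw [funext (psi_eq u)]
  exact (ContDiffAt.sum fun k _ => ContDiffAt.sum fun l _ =>
    ((hU l l).mul ((hp k).mul (hp k))).sub ((hU l k).mul ((hp k).mul (hp l)))).sub
      (contDiffAt_const.mul (hu.of_le (by norm_num)))

/-- The inverse Hessian in the form cancels the Hessian coming from `∇u_k`. -/
theorem gradForm_partialD (hu : ContDiffAt ℝ (2 : ℕ) u x) (hdet : (hessian u x).det = 1)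
    (f : EuclideanSpace ℝ (Fin n) → ℝ) (k : Fin n) :
    gradForm (hessian u x).adjugate f (partialD k u) x = partialD k f x := by
  have h : ∀ i, ∑ j, (hessian u x).adjugate i j * hessian u x j k =
      (1 : Matrix (Fin n) (Fin n) ℝ) i k := fun i => by
    rw [← Matrix.mul_apply, Matrix.adjugate_mul, hdet, one_smul]
  calc gradForm (hessian u x).adjugate f (partialD k u) x
      = ∑ i, partialD i f x * ∑ j, (hessian u x).adjugate i j * hessian u x j k := by
        simp only [gradForm, Finset.mul_sum]
        refine Finset.sum_congr rfl fun i _ => Finset.sum_congr rfl fun j _ => ?_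
        rw [(hessian_isSymm hu le_rfl).apply k j]
        simp only [hessian, Matrix.of_apply]
        ring
    _ = partialD k f x := by simp [h, Matrix.one_apply]

theorem gradForm_mul_right {A : Matrix (Fin n) (Fin n) ℝ} {f g h : EuclideanSpace ℝ (Fin n) → ℝ}
    (hg : DifferentiableAt ℝ g x) (hh : DifferentiableAt ℝ h x) :
    gradForm A f (fun y => g y * h y) x = g x * gradForm A f h x + h x * gradForm A f g x := by
  simp only [gradForm, partialD_mul hg hh, Finset.mul_sum, ← Finset.sum_add_distrib]
  exact Finset.sum_congr rfl fun i _ => Finset.sum_congr rfl fun j _ => by ring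

theorem ellipticOp_hessian_mul_partialD (hu : ContDiffAt ℝ (4 : ℕ) u x)
    (hdet : ∀ᶠ y in 𝓝 x, (hessian u y).det = 1) (a b k l : Fin n) :
    ellipticOp (hessian u x).adjugate
      (fun y => hessian u y a b * (partialD k u y * partialD l u y)) x =
      2 * (hessian u x a b * hessian u x k l) +
      ((hessian u x).adjugate * thirdD u x a * (hessian u x).adjugate * thirdD u x b).trace *
        (partialD k u x * partialD l u x) +
      2 * (partialD k u x * thirdD u x l a b + partialD l u x * thirdD u x k a b) := by
  have hu3 : ContDiffAt ℝ (3 : ℕ) u x := hu.of_le (by norm_num)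
  have hu2 : ContDiffAt ℝ (2 : ℕ) u x := hu.of_le (by norm_num)
  have hp : ∀ k, ContDiffAt ℝ (2 : ℕ) (partialD k u) x := fun k => hu.partialD (by norm_num) k
  have hpd := fun k => (hp k).differentiableAt_nat (by norm_num)
  have hA : (hessian u x).adjugate.IsSymm := by
    rw [Matrix.IsSymm, Matrix.adjugate_transpose, (hessian_isSymm hu2 le_rfl).eq]
  rw [ellipticOp_mul hA (contDiffAt_hessian hu le_rfl a b) ((hp k).mul (hp l)),
    ellipticOp_mul hA (hp k) (hp l), ellipticOp_partialD hu3 hdet, ellipticOp_partialD hu3 hdet,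
    ellipticOp_hessian hu hdet, gradForm_mul_right (hpd k) (hpd l),
    gradForm_partialD hu2 hdet.self_of_nhds, gradForm_partialD hu2 hdet.self_of_nhds,
    gradForm_partialD hu2 hdet.self_of_nhds]
  simp only [thirdD, Matrix.of_apply]
  have : partialD l (partialD k u) x = hessian u x k l := rfl
  rw [this]
  ring

theorem ellipticOp_psi (hu : ContDiffAt ℝ (4 : ℕ) u x)
    (hdet : ∀ᶠ y in 𝓝 x, (hessian u y).det = 1) :
    ellipticOp (hessian u x).adjugate (psi u) x =
      (∑ k, ∑ l, (((hessian u x).adjugate * thirdD u x l * (hessian u x).adjugate *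
          thirdD u x l).trace * (partialD k u x * partialD k u x) -
        ((hessian u x).adjugate * thirdD u x l * (hessian u x).adjugate *
          thirdD u x k).trace * (partialD k u x * partialD l u x))) +
      2 * ((hessian u x).trace ^ 2 - (hessian u x * hessian u x).trace - n * (n - 1)) := by
  have hu3 : ContDiffAt ℝ (3 : ℕ) u x := hu.of_le (by norm_num)
  have hu2 : ContDiffAt ℝ (2 : ℕ) u x := hu.of_le (by norm_num)
  have hp : ∀ k, ContDiffAt ℝ (2 : ℕ) (partialD k u) x := fun k => hu.partialD (by norm_num) k
  have hU : ∀ k l, ContDiffAt ℝ (2 : ℕ) (fun y => hessian u y k l) x :=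
    contDiffAt_hessian hu le_rfl
  have h1 : ∀ k l, ContDiffAt ℝ (2 : ℕ)
      (fun y => hessian u y l l * (partialD k u y * partialD k u y)) x := fun k l =>
    (hU l l).mul ((hp k).mul (hp k))
  have h2 : ∀ k l, ContDiffAt ℝ (2 : ℕ)
      (fun y => hessian u y l k * (partialD k u y * partialD l u y)) x := fun k l =>
    (hU l k).mul ((hp k).mul (hp l))
  have hLu : ellipticOp (hessian u x).adjugate u x = n := by
    have h : ellipticOp (hessian u x).adjugate u x =
        ((hessian u x).adjugate * hessian u x).trace := by
      simp only [ellipticOp, Matrix.trace, Matrix.diag, Matrix.mul_apply]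
      exact Finset.sum_congr rfl fun i _ => Finset.sum_congr rfl fun j _ => by
        rw [(hessian_isSymm hu2 le_rfl).apply i j]
    rw [h, Matrix.adjugate_mul, hdet.self_of_nhds, one_smul]
    simp
  rw [funext (psi_eq u), ellipticOp_sub (ContDiffAt.sum fun k _ => ContDiffAt.sum fun l _ =>
    (h1 k l).sub (h2 k l)) (contDiffAt_const.mul hu2), ellipticOp_const_mul hu2, hLu,
    ellipticOp_sum fun k _ => ContDiffAt.sum fun l _ => (h1 k l).sub (h2 k l)]
  simp only [ellipticOp_sum (fun l _ => (h1 _ l).sub (h2 _ l)), ellipticOp_sub (h1 _ _) (h2 _ _),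
    ellipticOp_hessian_mul_partialD hu hdet]
  -- By symmetry of third derivatives, the terms linear in them coming from the two halves of `ψ`
  -- all equal `∑ u_k u_{kll}` and cancel.
  have e1 : ∑ k, ∑ l, partialD k u x * thirdD u x l l k =
      ∑ k, ∑ l, partialD k u x * thirdD u x k l l :=
    Finset.sum_congr rfl fun k _ => Finset.sum_congr rfl fun l _ => by rw [thirdD_rotate hu3 l k l]
  have e2 : ∑ k, ∑ l, partialD l u x * thirdD u x k l k =
      ∑ k, ∑ l, partialD k u x * thirdD u x k l l := by
    rw [Finset.sum_comm]
    exact Finset.sum_congr rfl fun k _ => Finset.sum_congr rfl fun l _ => by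
      rw [thirdD_swap hu3 k l l, thirdD_rotate hu3 l k l]
  have e3 : (hessian u x).trace ^ 2 = ∑ k, ∑ l, hessian u x l l * hessian u x k k := by
    rw [sq, Matrix.trace, Finset.sum_mul_sum, Finset.sum_comm]
    rfl
  have e4 : (hessian u x * hessian u x).trace = ∑ k, ∑ l, hessian u x l k * hessian u x k l := by
    simp only [Matrix.trace, Matrix.diag, Matrix.mul_apply]
    exact Finset.sum_congr rfl fun k _ => Finset.sum_congr rfl fun l _ => mul_comm _ _
  simp only [← Finset.mul_sum] at e1 e2
  rw [e3, e4]
  simp only [mul_add, Finset.sum_sub_distrib, Finset.sum_add_distrib, ← Finset.mul_sum, e1, e2]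
  ring

theorem ellipticOp_psi_nonneg (hu : ContDiffAt ℝ (4 : ℕ) u x)
    (hdet : ∀ᶠ y in 𝓝 x, (hessian u y).det = 1) (hpos : (hessian u x).PosDef) :
    0 ≤ ellipticOp (hessian u x).adjugate (psi u) x ∧
    (ellipticOp (hessian u x).adjugate (psi u) x = 0 →
      (3 ≤ n → hessian u x = 1) ∧
      ((∃ k, partialD k u x ≠ 0) → ∀ k, thirdD u x k = 0)) := by
  have hu3 : ContDiffAt ℝ (3 : ℕ) u x := hu.of_le (by norm_num)
  have hA : (hessian u x).adjugate.PosDef := by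
    have h := hpos.inv
    rwa [Matrix.inv_def, hdet.self_of_nhds, Ring.inverse_one, one_smul] at h
  have hT : ∀ k, (thirdD u x k).IsSymm := fun k => by
    ext i j
    exact thirdD_swap hu3 j i k
  have h1 := hA.sum_trace_sub hT fun k => partialD k u x
  have h2 := hpos.le_trace_sq_sub hdet.self_of_nhds
  rw [ellipticOp_psi hu hdet]
  refine ⟨by linarith [h1.1, h2.1], fun h0 => ⟨fun hn => h2.2 (by linarith [h1.1, h2.1]) hn, ?_⟩⟩
  rintro ⟨k, hk⟩
  exact hA.tensor_eq_zero hT (fun i j k => thirdD_rotate hu3 i j k)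
    (partialD_hessian_trace hu3 hdet) (p := fun k => partialD k u x)
    (fun h => hk (congrFun h k)) (h1.2 (by linarith [h1.1, h2.1]))

end DifferentialInequality

/-! ### Interior maxima, the Hopf lemma and the strong maximum principle -/

section MaximumPrinciple

variable {n : ℕ} {f : EuclideanSpace ℝ (Fin n) → ℝ} {x : EuclideanSpace ℝ (Fin n)}

theorem deriv_deriv_line (hf : ContDiffAt ℝ (2 : ℕ) f x) (v : EuclideanSpace ℝ (Fin n)) :
    deriv (deriv fun t : ℝ => f (x + t • v)) 0 = ∑ i, ∑ j, v i * v j * hessian f x i j ∧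
      deriv (fun t : ℝ => f (x + t • v)) 0 = ∑ i, v i * partialD i f x := by
  have hc : Tendsto (fun t : ℝ => x + t • v) (𝓝 0) (𝓝 x) := by
    have : Continuous fun t : ℝ => x + t • v := by fun_prop
    simpa using this.tendsto 0
  have h1 : (deriv fun t : ℝ => f (x + t • v)) =ᶠ[𝓝 0]
      fun t => ∑ i, v i * partialD i f (x + t • v) := by
    filter_upwards [hc.eventually (hf.eventually_differentiableAt (by simp))] with t ht
    exact ht.hasDerivAt_line.deriv
  refine ⟨?_, by simpa using h1.self_of_nhds⟩
  rw [h1.deriv_eq]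
  have h2 : ∀ i, HasDerivAt (fun t : ℝ => partialD i f (x + t • v))
      (∑ j, v j * hessian f x i j) 0 := by
    intro i
    have hd : DifferentiableAt ℝ (partialD i f) (x + (0 : ℝ) • v) := by
      simpa using (hf.partialD (k := 1) le_rfl i).differentiableAt_nat le_rfl
    simpa [hessian] using hd.hasDerivAt_line
  rw [(HasDerivAt.fun_sum fun i (_ : i ∈ Finset.univ) => (h2 i).const_mul (v i)).deriv]
  simp only [Finset.mul_sum, mul_assoc]

/-- If the second derivative along some line were positive, the point would also be a local minimum
along that line; the restriction would then be locally constant, with zero second derivative. -/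
theorem IsLocalMax.hessian_nonpos (hf : ContDiffAt ℝ (2 : ℕ) f x) (hmax : IsLocalMax f x)
    (v : EuclideanSpace ℝ (Fin n)) : ∑ i, ∑ j, v i * v j * hessian f x i j ≤ 0 := by
  by_contra! hpos
  obtain ⟨h2, -⟩ := deriv_deriv_line hf v
  set g : ℝ → ℝ := fun t => f (x + t • v) with hg
  have hc : ContinuousAt (fun t : ℝ => x + t • v) 0 := by fun_prop
  have hgmax : IsLocalMax g 0 := by
    have : IsLocalMax f (x + (0 : ℝ) • v) := by simpa using hmax
    exact this.comp_continuous (g := fun t : ℝ => x + t • v) hc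
  have hgc : ContinuousAt g 0 := by
    have : ContinuousAt f (x + (0 : ℝ) • v) := by simpa using hf.continuousAt
    exact this.comp (f := fun t : ℝ => x + t • v) hc
  have hgmin : IsLocalMin g 0 :=
    isLocalMin_of_deriv_deriv_pos (by rw [h2]; exact hpos) hgmax.deriv_eq_zero hgc
  have hconst : g =ᶠ[𝓝 0] fun _ => g 0 := by
    filter_upwards [hgmax, hgmin] with t h1 h2 using le_antisymm h1 h2
  have h3 : deriv g =ᶠ[𝓝 0] fun _ => 0 := hconst.deriv.trans (by simp)
  rw [h3.deriv_eq, deriv_const] at h2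
  exact hpos.ne h2

theorem IsLocalMax.posSemidef_neg_hessian (hf : ContDiffAt ℝ (2 : ℕ) f x)
    (hmax : IsLocalMax f x) : (-hessian f x).PosSemidef := by
  refine Matrix.PosSemidef.of_dotProduct_mulVec_nonneg ?_ fun v => ?_
  · exact (hessian_isSymm hf le_rfl).neg
  · have h := hmax.hessian_nonpos hf (WithLp.toLp 2 v)
    simp only [Matrix.neg_mulVec, dotProduct_neg, star_trivial]
    rw [neg_nonneg]
    refine le_of_eq_of_le ?_ h
    simp only [dotProduct, Matrix.mulVec, Finset.mul_sum]
    exact Finset.sum_congr rfl fun i _ => Finset.sum_congr rfl fun j _ => by ring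

theorem ellipticOp_eq_trace {A : Matrix (Fin n) (Fin n) ℝ} (hf : ContDiffAt ℝ (2 : ℕ) f x) :
    ellipticOp A f x = (A * hessian f x).trace := by
  simp only [ellipticOp, Matrix.trace, Matrix.diag, Matrix.mul_apply]
  exact Finset.sum_congr rfl fun i _ => Finset.sum_congr rfl fun j _ => by
    rw [(hessian_isSymm hf le_rfl).apply]

theorem IsLocalMax.ellipticOp_nonpos {A : Matrix (Fin n) (Fin n) ℝ} (hA : A.PosSemidef)
    (hf : ContDiffAt ℝ (2 : ℕ) f x) (hmax : IsLocalMax f x) : ellipticOp A f x ≤ 0 := by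
  have h := hA.trace_mul_nonneg (hmax.posSemidef_neg_hessian hf)
  rw [Matrix.mul_neg, Matrix.trace_neg] at h
  rw [ellipticOp_eq_trace hf]
  linarith

/-- The quadratic polynomial `b ⬝ (z - c) + (z - c)ᵀ H (z - c) / 2`. -/
noncomputable def quadPoly (c : EuclideanSpace ℝ (Fin n)) (b : Fin n → ℝ)
    (H : Matrix (Fin n) (Fin n) ℝ) (z : EuclideanSpace ℝ (Fin n)) : ℝ :=
  ∑ i, b i * (z i - c i) + (1 / 2) * ∑ i, ∑ j, H i j * ((z i - c i) * (z j - c j))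

variable {c : EuclideanSpace ℝ (Fin n)} {b : Fin n → ℝ} {H : Matrix (Fin n) (Fin n) ℝ}

theorem contDiff_coord_sub {m : ℕ} (c : EuclideanSpace ℝ (Fin n)) (i : Fin n) :
    ContDiff ℝ m fun z : EuclideanSpace ℝ (Fin n) => z i - c i := by
  fun_prop

theorem contDiff_quadPoly {m : ℕ} : ContDiff ℝ m (quadPoly c b H) := by
  unfold quadPoly
  fun_prop

theorem partialD_coord_sub (c z : EuclideanSpace ℝ (Fin n)) (i k : Fin n) :
    partialD k (fun z : EuclideanSpace ℝ (Fin n) => z i - c i) z = if i = k then 1 else 0 := by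
  have h : HasFDerivAt (fun z : EuclideanSpace ℝ (Fin n) => z i - c i)
      (EuclideanSpace.proj (𝕜 := ℝ) i : EuclideanSpace ℝ (Fin n) →L[ℝ] ℝ) z :=
    (EuclideanSpace.proj (𝕜 := ℝ) i : EuclideanSpace ℝ (Fin n) →L[ℝ] ℝ).hasFDerivAt.sub_const _
  rw [partialD, h.fderiv]
  simp

theorem partialD_quadPoly (hH : H.IsSymm) (k : Fin n) (z : EuclideanSpace ℝ (Fin n)) :
    partialD k (quadPoly c b H) z = b k + ∑ j, H k j * (z j - c j) := by
  have hd : ∀ i z, DifferentiableAt ℝ (fun z : EuclideanSpace ℝ (Fin n) => z i - c i) z :=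
    fun i z => (contDiff_coord_sub (m := 1) c i).contDiffAt.differentiableAt_nat le_rfl
  have hd2 : ∀ i j z, DifferentiableAt ℝ
      (fun z : EuclideanSpace ℝ (Fin n) => (z i - c i) * (z j - c j)) z :=
    fun i j z => (hd i z).fun_mul (hd j z)
  unfold quadPoly
  rw [partialD_add (by fun_prop) (by fun_prop), partialD_const_mul (by fun_prop),
    partialD_sum (fun i _ => (hd i z).const_mul _),
    partialD_sum (F := fun i z => ∑ j, H i j * ((z.ofLp i - c.ofLp i) * (z.ofLp j - c.ofLp j)))
      (fun i _ => DifferentiableAt.fun_sum fun j _ => (hd2 i j z).const_mul _)]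
  simp only [partialD_sum (fun j _ => (hd2 _ j z).const_mul _), partialD_const_mul (hd _ z),
    partialD_const_mul (hd2 _ _ z), partialD_mul (hd _ z) (hd _ z), partialD_coord_sub]
  simp only [mul_add, Finset.sum_add_distrib, mul_ite, ite_mul, mul_one, one_mul, mul_zero,
    zero_mul, Finset.sum_ite_eq', Finset.mem_univ, if_true]
  rw [Finset.sum_comm (γ := Fin n) (f := fun i j => if i = k then H i j * (z j - c j) else 0)]
  simp only [Finset.sum_ite_eq', Finset.mem_univ, if_true]
  have : ∀ i, H i k = H k i := fun i => hH.apply k i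
  simp only [this]
  ring

theorem hessian_quadPoly (hH : H.IsSymm) (z : EuclideanSpace ℝ (Fin n)) :
    hessian (quadPoly c b H) z = H := by
  have hd : ∀ i z, DifferentiableAt ℝ (fun z : EuclideanSpace ℝ (Fin n) => z i - c i) z :=
    fun i z => (contDiff_coord_sub (m := 1) c i).contDiffAt.differentiableAt_nat le_rfl
  ext i j
  simp only [hessian, Matrix.of_apply]
  rw [funext (partialD_quadPoly hH i), partialD_add (by fun_prop) (by fun_prop), partialD_const,
    partialD_sum fun j _ => (hd j z).const_mul _]
  simp only [partialD_const_mul (hd _ z), partialD_coord_sub]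
  simp

/-- Hopf's lemma: a subsolution cannot have an interior maximum `x` that is strict relative to the
ball whose centre is `x + ν` and whose boundary passes through `x`. -/
theorem not_isMaxOn_of_lt_tangent_ball {Ω : Set (EuclideanSpace ℝ (Fin n))} (hΩ : IsOpen Ω)
    {A : EuclideanSpace ℝ (Fin n) → Matrix (Fin n) (Fin n) ℝ} (hA : ∀ y ∈ Ω, (A y).PosDef)
    (hAc : ∀ i j, ContinuousOn (fun y => A y i j) Ω) (hf : ∀ y ∈ Ω, ContDiffAt ℝ (2 : ℕ) f y)
    (hL : ∀ y ∈ Ω, 0 ≤ ellipticOp (A y) f y) (hx : x ∈ Ω) {ν : EuclideanSpace ℝ (Fin n)}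
    (hν : ν ≠ 0) (hlt : ∀ z ∈ Ω, z ≠ x → ‖z - x‖ ^ 2 ≤ 2 * inner ℝ ν (z - x) → f z < f x) :
    ¬ IsMaxOn f Ω x := by
  intro hmax
  have hν' : ν.ofLp ≠ 0 := fun h => hν (by ext i; exact congrFun h i)
  let q : EuclideanSpace ℝ (Fin n) → ℝ := fun y => ∑ i, ∑ j, A y i j * (ν i * ν j)
  have hqc : ContinuousOn q Ω := continuousOn_finsetSum _ fun i _ =>
    continuousOn_finsetSum _ fun j _ => (hAc i j).mul continuousOn_const
  have htc : ContinuousOn (fun y => (A y).trace) Ω :=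
    continuousOn_finsetSum _ fun i _ => hAc i i
  have hqpos : 0 < q x := by
    have h := (hA x hx).dotProduct_mulVec_pos hν'
    refine h.trans_eq ?_
    simp only [q, dotProduct, Matrix.mulVec, star_trivial, Finset.mul_sum]
    exact Finset.sum_congr rfl fun i _ => Finset.sum_congr rfl fun j _ => by ring
  -- The barrier will be `h = ν·d + K (ν·d)² - |d|²` with `d = z - x`. Then `L h = 2 (K q - tr A)`,
  -- so this choice of `K` makes `L h > 0` near `x`.
  obtain ⟨K, hK0, hK⟩ : ∃ K : ℝ, 0 < K ∧ (A x).trace < K * q x := by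
    refine ⟨|(A x).trace| / q x + 1, by positivity, ?_⟩
    rw [add_mul, div_mul_cancel₀ _ hqpos.ne']
    linarith [le_abs_self (A x).trace]
  let H : Matrix (Fin n) (Fin n) ℝ := (2 * K) • Matrix.vecMulVec ν ν - (2 : ℝ) • 1
  have hHs : H.IsSymm := by
    ext i j
    simp [H, Matrix.vecMulVec_apply, Matrix.one_apply, eq_comm, mul_comm]
  let h := quadPoly x ν H
  have hh : ∀ z, h z = inner ℝ ν (z - x) + K * inner ℝ ν (z - x) ^ 2 - ‖z - x‖ ^ 2 := by
    intro z
    have h1 : inner ℝ ν (z - x) = ∑ i, ν i * (z i - x i) := by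
      simp [PiLp.inner_apply, mul_comm]
    have h2 : ‖z - x‖ ^ 2 = ∑ i, (z i - x i) * (z i - x i) := by
      rw [EuclideanSpace.real_norm_sq_eq]
      exact Finset.sum_congr rfl fun i _ => by simp [sq]
    have h3 : ∀ d : Fin n → ℝ, (1 / 2) * ∑ i, ∑ j, H i j * (d i * d j) =
        K * (∑ i, ∑ j, ν i * d i * (ν j * d j)) - ∑ i, d i * d i := by
      intro d
      have h4 : ∑ i, d i * d i = ∑ i, ∑ j, (1 : Matrix (Fin n) (Fin n) ℝ) i j * (d i * d j) := by
        simp [Matrix.one_apply]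
      rw [h4]
      simp only [Finset.mul_sum, ← Finset.sum_sub_distrib, H, Matrix.sub_apply,
        Matrix.smul_apply, Matrix.vecMulVec_apply, smul_eq_mul]
      exact Finset.sum_congr rfl fun i _ => Finset.sum_congr rfl fun j _ => by ring
    rw [h1, h2, sq, Finset.sum_mul_sum, add_sub_assoc, ← h3 fun i => z i - x i]
    rfl
  have hLh : ∀ y, ellipticOp (A y) h y = 2 * (K * q y - (A y).trace) := by
    intro y
    simp only [ellipticOp, h, hessian_quadPoly hHs, H, Matrix.sub_apply, Matrix.smul_apply,
      Matrix.vecMulVec_apply, smul_eq_mul, mul_sub, Finset.sum_sub_distrib]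
    congr 1
    · simp only [q, Finset.mul_sum]
      exact Finset.sum_congr rfl fun i _ => Finset.sum_congr rfl fun j _ => by ring
    · simp [Matrix.one_apply, Matrix.trace, Finset.mul_sum, mul_comm]
  have hev : ∀ᶠ y in 𝓝 x, y ∈ Ω ∧ (A y).trace < K * q y ∧ |K * inner ℝ ν (y - x)| < 1 := by
    have hΩx := hΩ.mem_nhds hx
    have h1 : ∀ᶠ y in 𝓝 x, y ∈ Ω := hΩx
    refine h1.and (Eventually.and ?_ ?_)
    · exact ((htc.continuousAt hΩx).eventually_lt
        (continuousAt_const.mul (hqc.continuousAt hΩx)) hK)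
    · have hc : ContinuousAt (fun y => |K * inner ℝ ν (y - x)|) x := by fun_prop
      exact hc.eventually_lt continuousAt_const (by simp)
  obtain ⟨ρ, hρ, hball⟩ := Metric.nhds_basis_closedBall.eventually_iff.mp hev
  have hfc : ContinuousOn f (Metric.closedBall x ρ) := fun y hy =>
    (hf y (hball hy).1).continuousAt.continuousWithinAt
  have hhc : Continuous h := (contDiff_quadPoly (m := 0)).continuous
  -- Outside the tangent ball the barrier is negative. If `ν·d ≥ 0`, then `|K ν·d| < 1` gives `h ≤ 2
  -- ν·d - |d|²`; if `ν·d < 0`, the same bound keeps `ν·d (1 + K ν·d)` negative.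
  have hout : ∀ z ∈ Metric.closedBall x ρ, 2 * inner ℝ ν (z - x) < ‖z - x‖ ^ 2 → h z < 0 := by
    intro z hz hlt
    have h1 := abs_lt.mp (hball hz).2.2
    rw [hh]
    rcases le_or_gt 0 (inner ℝ ν (z - x)) with h0 | h0
    · nlinarith
    · nlinarith [sq_nonneg ‖z - x‖]
  -- On the part of the sphere in the tangent ball, `f` stays below `f x` by a fixed gap, which a
  -- small `ε` respects; on the rest `h < 0`. So the maximum of `f + ε h` over the closed ball, at
  -- least `f x`, is interior, against `L (f + ε h) > 0`.
  obtain ⟨ε, hε, hεlt⟩ : ∃ ε : ℝ, 0 < ε ∧ ∀ z ∈ Metric.sphere x ρ, f z + ε * h z < f x := by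
    let S := Metric.sphere x ρ ∩ {z | ‖z - x‖ ^ 2 ≤ 2 * inner ℝ ν (z - x)}
    have hSc : IsCompact S := (isCompact_sphere x ρ).inter_right
      (isClosed_le (by fun_prop) (by fun_prop))
    have hSb : S ⊆ Metric.closedBall x ρ := fun z hz => Metric.sphere_subset_closedBall hz.1
    have hSlt : ∀ z ∈ S, f z < f x := fun z hz => hlt z (hball (hSb hz)).1
      (Metric.ne_of_mem_sphere hz.1 hρ.ne') hz.2
    obtain ⟨ε, hε, hS⟩ : ∃ ε : ℝ, 0 < ε ∧ ∀ z ∈ S, f z + ε * h z < f x := by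
      rcases S.eq_empty_or_nonempty with hS | hS
      · exact ⟨1, one_pos, by simp [hS]⟩
      · obtain ⟨z₁, hz₁, h1⟩ := hSc.exists_isMaxOn hS (hfc.mono hSb)
        obtain ⟨z₂, hz₂, h2⟩ := hSc.exists_isMaxOn hS hhc.continuousOn
        have hd : 0 < f x - f z₁ := sub_pos.mpr (hSlt z₁ hz₁)
        refine ⟨(f x - f z₁) / (|h z₂| + 1), by positivity, fun z hz => ?_⟩
        have h3 : f z ≤ f z₁ := h1 hz
        have h4 : h z < |h z₂| + 1 := by
          have : h z ≤ h z₂ := h2 hz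
          linarith [le_abs_self (h z₂)]
        have h5 : (f x - f z₁) / (|h z₂| + 1) * h z < f x - f z₁ := by
          rw [div_mul_eq_mul_div, div_lt_iff₀ (by positivity)]
          exact mul_lt_mul_of_pos_left h4 hd
        linarith
    refine ⟨ε, hε, fun z hz => ?_⟩
    by_cases hzS : ‖z - x‖ ^ 2 ≤ 2 * inner ℝ ν (z - x)
    · exact hS z ⟨hz, hzS⟩
    · have hzb := Metric.sphere_subset_closedBall hz
      have h1 := hout z hzb (not_le.mp hzS)
      have h2 : f z ≤ f x := hmax (hball hzb).1
      nlinarith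
  have hgc : ContinuousOn (fun z => f z + ε * h z) (Metric.closedBall x ρ) :=
    hfc.add (continuousOn_const.mul hhc.continuousOn)
  obtain ⟨z, hz, hzmax⟩ := (isCompact_closedBall x ρ).exists_isMaxOn
    ⟨x, Metric.mem_closedBall_self hρ.le⟩ hgc
  have hzx : f x ≤ f z + ε * h z := by
    have := hzmax (Metric.mem_closedBall_self hρ.le)
    simpa [hh] using this
  have hzball : z ∈ Metric.ball x ρ := by
    rcases (Metric.mem_closedBall.mp hz).lt_or_eq with h1 | h1
    · exact h1
    · exact absurd (hεlt z h1) (not_lt.mpr hzx)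
  have hloc : IsLocalMax (fun z => f z + ε * h z) z :=
    (hzmax.on_subset Metric.ball_subset_closedBall).isLocalMax (Metric.isOpen_ball.mem_nhds hzball)
  obtain ⟨hzΩ, hzK, -⟩ := hball hz
  have hh2 : ContDiffAt ℝ (2 : ℕ) h z := contDiff_quadPoly.contDiffAt
  have h1 := hloc.ellipticOp_nonpos (hA z hzΩ).posSemidef ((hf z hzΩ).add (contDiffAt_const.mul hh2))
  rw [ellipticOp_add (hf z hzΩ) (contDiffAt_const.mul hh2), ellipticOp_const_mul hh2, hLh] at h1
  have h2 := hL z hzΩ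
  nlinarith [mul_pos hε (sub_pos.mpr hzK)]

/-- The strong maximum principle. -/
theorem eqOn_of_isMaxOn_of_ellipticOp_nonneg {Ω : Set (EuclideanSpace ℝ (Fin n))} (hΩ : IsOpen Ω)
    (hconn : IsPreconnected Ω)
    {A : EuclideanSpace ℝ (Fin n) → Matrix (Fin n) (Fin n) ℝ} (hA : ∀ y ∈ Ω, (A y).PosDef)
    (hAc : ∀ i j, ContinuousOn (fun y => A y i j) Ω) (hf : ∀ y ∈ Ω, ContDiffAt ℝ (2 : ℕ) f y)
    (hL : ∀ y ∈ Ω, 0 ≤ ellipticOp (A y) f y) (hx : x ∈ Ω) (hmax : IsMaxOn f Ω x) :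
    ∀ y ∈ Ω, f y = f x := by
  have hfc : ContinuousOn f Ω := fun y hy => (hf y hy).continuousAt.continuousWithinAt
  have hopen : IsOpen {y | y ∈ Ω ∧ f y = f x} := by
    rw [Metric.isOpen_iff]
    rintro q ⟨hq, hqx⟩
    obtain ⟨r, hr, hball⟩ := Metric.isOpen_iff.mp hΩ q hq
    refine ⟨r / 2, by positivity, fun y hy => ?_⟩
    have hyΩ : y ∈ Ω := hball (Metric.ball_subset_ball (by linarith) hy)
    refine ⟨hyΩ, ?_⟩
    by_contra hne
    rw [Metric.mem_ball] at hy
    have hsub : Metric.closedBall y (dist y q) ⊆ Ω := fun z hz => hball (by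
      rw [Metric.mem_closedBall] at hz
      rw [Metric.mem_ball]
      linarith [dist_triangle z y q])
    have hcomp : IsCompact (Metric.closedBall y (dist y q) ∩ f ⁻¹' {f x}) :=
      (isCompact_closedBall _ _).of_isClosed_subset
        ((hfc.mono hsub).preimage_isClosed_of_isClosed Metric.isClosed_closedBall
          isClosed_singleton) Set.inter_subset_left
    -- The point `z` of the maximum set nearest to `y`: the open ball about `y` through `z` misses
    -- that set.
    obtain ⟨z, ⟨hz, hzx⟩, hzmin⟩ := hcomp.exists_isMinOn
      ⟨q, by simp [dist_comm], hqx⟩ (f := fun z => dist z y) (by fun_prop)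
    have hzx : f z = f x := hzx
    have hzy : z ≠ y := fun h => hne (h ▸ hzx)
    have hzmax : IsMaxOn f Ω z := fun w hw => by
      have : f w ≤ f x := hmax hw
      simpa [hzx] using this
    -- The factor `1 / 2` gives a ball of half the radius, internally tangent at `z`. Its closure
    -- meets the larger sphere only at `z`, which makes the maximum strict there.
    refine not_isMaxOn_of_lt_tangent_ball hΩ hA hAc hf hL (hsub hz)
      (ν := (1 / 2 : ℝ) • (y - z)) ?_ (fun w hw hwz hle => ?_) hzmax
    · simpa [sub_eq_zero] using hzy.symm
    · refine lt_of_le_of_ne (hzmax hw) fun heq => ?_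
      have h1 : dist w y < dist z y := by
        have h0 : 0 < ‖w - z‖ := norm_pos_iff.mpr (sub_ne_zero.mpr hwz)
        have h2 : ‖w - y‖ ^ 2 = ‖w - z‖ ^ 2 - 2 * inner ℝ (y - z) (w - z) + ‖y - z‖ ^ 2 := by
          rw [show w - y = (w - z) - (y - z) by abel, norm_sub_sq_real, real_inner_comm]
        rw [inner_smul_left] at hle
        simp only [RCLike.conj_to_real] at hle
        rw [dist_comm z y, dist_eq_norm, dist_eq_norm]
        refine lt_of_pow_lt_pow_left₀ 2 (norm_nonneg _) ?_
        rw [h2]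
        nlinarith [sq_pos_of_pos h0]
      have h3 : dist z y ≤ dist w y := hzmin ⟨by
        rw [Metric.mem_closedBall]
        exact h1.le.trans (by simpa using hz), by simp [heq, hzx]⟩
      linarith
  have hsub := hconn.subset_of_closure_inter_subset hopen ⟨x, hx, hx, rfl⟩ (by
    rintro y ⟨hy, hyΩ⟩
    refine ⟨hyΩ, ?_⟩
    by_contra hne
    have hev : ∀ᶠ z in 𝓝 y, f z ≠ f x := (hf y hyΩ).continuousAt.eventually_ne hne
    obtain ⟨z, h1, h2⟩ := (mem_closure_iff_frequently.mp hy).and_eventually hev |>.exists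
    exact h2 h1.2)
  exact fun y hy => (hsub hy).2

end MaximumPrinciple

/-! ### Convexity, comparison, and the boundary maximum of `ψ` -/

section Solution

variable {n : ℕ} {Ω : Set (EuclideanSpace ℝ (Fin n))} {u v : EuclideanSpace ℝ (Fin n) → ℝ}
  {x : EuclideanSpace ℝ (Fin n)}

/-- After subtracting the tangent plane, a negative second derivative along a line would give a
local maximum there; midpoint convexity then forces the restriction to be locally constant, a
contradiction. -/
theorem ConvexOn.posSemidef_hessian (hΩ : IsOpen Ω) (hc : ConvexOn ℝ Ω u)
    (hu : ContDiffAt ℝ (2 : ℕ) u x) (hx : x ∈ Ω) : (hessian u x).PosSemidef := by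
  let ℓ := quadPoly x (fun k => partialD k u x) 0
  have hℓ : ∀ z, ℓ z = ∑ i, partialD i u x * (z i - x i) := fun z => by simp [ℓ, quadPoly]
  have hℓ2 : ContDiffAt ℝ (2 : ℕ) ℓ x := contDiff_quadPoly.contDiffAt
  have h0 : (0 : Matrix (Fin n) (Fin n) ℝ).IsSymm := Matrix.isSymm_zero
  have hw2 : ContDiffAt ℝ (2 : ℕ) (fun z => u z - ℓ z) x := hu.sub hℓ2
  have hhess : hessian (fun z => u z - ℓ z) x = hessian u x := by
    rw [hessian_sub hu hℓ2, hessian_quadPoly h0, sub_zero]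
  have hgrad : ∀ i, partialD i (fun z => u z - ℓ z) x = 0 := fun i => by
    rw [partialD_sub (hu.differentiableAt_nat (by simp)) (hℓ2.differentiableAt_nat (by simp)),
      partialD_quadPoly h0]
    simp
  refine Matrix.PosSemidef.of_dotProduct_mulVec_nonneg (hessian_isSymm hu le_rfl) fun v => ?_
  obtain ⟨h2, h1⟩ := deriv_deriv_line hw2 (WithLp.toLp 2 v)
  set v' : EuclideanSpace ℝ (Fin n) := WithLp.toLp 2 v
  have hS : star v ⬝ᵥ (hessian u x).mulVec v = ∑ i, ∑ j, v' i * v' j * hessian u x i j := by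
    simp only [dotProduct, Matrix.mulVec, Finset.mul_sum, star_trivial]
    exact Finset.sum_congr rfl fun i _ => Finset.sum_congr rfl fun j _ => by
      simp only [v']; ring
  rw [hS]
  rw [hhess] at h2
  simp only [hgrad, mul_zero, Finset.sum_const_zero] at h1
  by_contra! hneg
  set g : ℝ → ℝ := fun t => u (x + t • v') - ℓ (x + t • v') with hg
  have hlc : ContinuousAt (fun t : ℝ => x + t • v') 0 := by fun_prop
  have hgc : ContinuousAt g 0 := by
    have : ContinuousAt (fun z => u z - ℓ z) (x + (0 : ℝ) • v') := by
      simpa using hw2.continuousAt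
    exact this.comp (f := fun t : ℝ => x + t • v') hlc
  have hgmax : IsLocalMax g 0 := isLocalMax_of_deriv_deriv_neg (by rw [h2]; exact hneg) h1 hgc
  have hconst : g =ᶠ[𝓝 0] fun _ => g 0 := by
    have hΩx : Ω ∈ 𝓝 (x + (0 : ℝ) • v') := by simpa using hΩ.mem_nhds hx
    have hin : ∀ᶠ t in 𝓝 (0 : ℝ), x + t • v' ∈ Ω := hlc.eventually_mem hΩx
    have hneg0 : Tendsto (fun t : ℝ => -t) (𝓝 0) (𝓝 0) := by simpa using tendsto_neg (0 : ℝ)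
    filter_upwards [hgmax, hneg0.eventually hgmax, hin, hneg0.eventually hin] with t a1 a2 a3 a4
    have hmid := hc.2 a3 a4 (by norm_num : (0 : ℝ) ≤ 1 / 2) (by norm_num : (0 : ℝ) ≤ 1 / 2)
      (by norm_num)
    have hx' : (1 / 2 : ℝ) • (x + t • v') + (1 / 2 : ℝ) • (x + (-t) • v') = x := by module
    rw [hx'] at hmid
    have hlin : ℓ (x + t • v') + ℓ (x + (-t) • v') = 2 * ℓ x := by
      simp [hℓ]
    have hg0 : g 0 = u x - ℓ x := by simp [hg]
    refine le_antisymm a1 ?_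
    simp only [smul_eq_mul] at hmid
    rw [hg0] at a2 ⊢
    simp only [hg] at a2 ⊢
    linarith
  have h3 : deriv g =ᶠ[𝓝 0] fun _ => 0 := hconst.deriv.trans (by simp)
  rw [h3.deriv_eq, deriv_const] at h2
  exact hneg.ne h2.symm

theorem IsStrictlyConvexSolution.contDiffAt (hΩ : IsOpen Ω) (hu : IsStrictlyConvexSolution Ω u)
    (hx : x ∈ Ω) : ContDiffAt ℝ (4 : ℕ) u x := by
  have h := hu.contDiffOn.contDiffAt (hΩ.mem_nhds hx)
  exact_mod_cast h

theorem IsStrictlyConvexSolution.eventually_det (hΩ : IsOpen Ω)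
    (hu : IsStrictlyConvexSolution Ω u) (hx : x ∈ Ω) : ∀ᶠ y in 𝓝 x, (hessian u y).det = 1 :=
  eventually_of_mem (hΩ.mem_nhds hx) hu.det_hessian

theorem IsStrictlyConvexSolution.posDef (hΩ : IsOpen Ω) (hu : IsStrictlyConvexSolution Ω u)
    (hx : x ∈ Ω) : (hessian u x).PosDef :=
  (hu.strictConvexOn.convexOn.posSemidef_hessian hΩ
    ((hu.contDiffAt hΩ hx).of_le (by norm_num)) hx).posDef_iff_det_ne_zero.mpr
      (by rw [hu.det_hessian x hx]; exact one_ne_zero)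

theorem not_isLocalMax_of_posDef (hn : 0 < n) (hu : ContDiffAt ℝ (2 : ℕ) u x)
    (hpos : (hessian u x).PosDef) : ¬ IsLocalMax u x := by
  intro hmax
  have : Nonempty (Fin n) := ⟨⟨0, hn⟩⟩
  have h1 := (hmax.posSemidef_neg_hessian hu).trace_nonneg
  have h2 := hpos.trace_pos
  rw [Matrix.trace_neg] at h1
  linarith

theorem mem_of_mem_closure_of_notMem_frontier (hΩ : IsOpen Ω) (h : x ∈ closure Ω)
    (hf : x ∉ frontier Ω) : x ∈ Ω := by
  by_contra hx
  exact hf (by rw [hΩ.frontier_eq]; exact ⟨h, hx⟩)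

/-- A positive definite Hessian excludes interior maxima, so the maximum over the closure is the
boundary value `0` and is not attained inside. -/
theorem neg_of_posDef_hessian (hn : 0 < n) (hΩ : IsOpen Ω) (hb : Bornology.IsBounded Ω)
    (hc : ContinuousOn u (closure Ω)) (h2 : ∀ y ∈ Ω, ContDiffAt ℝ (2 : ℕ) u y)
    (hpos : ∀ y ∈ Ω, (hessian u y).PosDef) (h0 : ∀ y ∈ frontier Ω, u y = 0) (hx : x ∈ Ω) :
    u x < 0 := by
  have hnm : ∀ y ∈ Ω, ¬ IsMaxOn u Ω y := fun y hy hmax =>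
    not_isLocalMax_of_posDef hn (h2 y hy) (hpos y hy) (hmax.isLocalMax (hΩ.mem_nhds hy))
  obtain ⟨z, hz, hmax⟩ := hb.isCompact_closure.exists_isMaxOn ⟨x, subset_closure hx⟩ hc
  have hzf : z ∈ frontier Ω := by
    by_contra hzf
    exact hnm z (mem_of_mem_closure_of_notMem_frontier hΩ hz hzf) (hmax.on_subset subset_closure)
  have hle : ∀ y ∈ Ω, u y ≤ 0 := fun y hy => by
    have : u y ≤ u z := hmax (subset_closure hy)
    rwa [h0 z hzf] at this
  refine lt_of_le_of_ne (hle x hx) fun hx0 => hnm x hx fun y hy => ?_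
  simpa [hx0] using hle y hy

theorem adjugate_hessian_posDef (hdet : (hessian u x).det = 1) (hpos : (hessian u x).PosDef) :
    (hessian u x).adjugate.PosDef := by
  have h := hpos.inv
  rwa [Matrix.inv_def, hdet, Ring.inverse_one, one_smul] at h

/-- At an interior maximum of `u - t v`, `D²u ≤ t D²v`. Pairing with `adj D²v` bounds `tr (adj D²v *
D²u)` by `t n < n`, while the arithmetic-geometric mean inequality bounds it below by `n`. The
factor `t < 1` supplies the strictness and is sent to `1` afterwards. -/
theorem le_mul_of_det_hessian_eq_one (hn : 0 < n) (hΩ : IsOpen Ω) (hb : Bornology.IsBounded Ω)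
    (huc : ContinuousOn u (closure Ω)) (hu2 : ∀ y ∈ Ω, ContDiffAt ℝ (2 : ℕ) u y)
    (hup : ∀ y ∈ Ω, (hessian u y).PosDef) (hud : ∀ y ∈ Ω, (hessian u y).det = 1)
    (hu0 : ∀ y ∈ frontier Ω, u y = 0)
    (hvc : ContinuousOn v (closure Ω)) (hv2 : ∀ y ∈ Ω, ContDiffAt ℝ (2 : ℕ) v y)
    (hvp : ∀ y ∈ Ω, (hessian v y).PosDef) (hvd : ∀ y ∈ Ω, (hessian v y).det = 1)
    (hv0 : ∀ y ∈ frontier Ω, v y = 0) {t : ℝ} (ht : t < 1) (hx : x ∈ Ω) : u x ≤ t * v x := by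
  obtain ⟨z, hz, hmax⟩ := hb.isCompact_closure.exists_isMaxOn ⟨x, subset_closure hx⟩
    (f := fun y => u y - t * v y) (huc.sub (continuousOn_const.mul hvc))
  have hzf : z ∈ frontier Ω := by
    by_contra hzf
    have hzΩ := mem_of_mem_closure_of_notMem_frontier hΩ hz hzf
    have hloc : IsLocalMax (fun y => u y - t * v y) z :=
      (hmax.on_subset subset_closure).isLocalMax (hΩ.mem_nhds hzΩ)
    have htv : ContDiffAt ℝ (2 : ℕ) (fun y => t * v y) z := contDiffAt_const.mul (hv2 z hzΩ)
    have h1 := hloc.posSemidef_neg_hessian ((hu2 z hzΩ).sub htv)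
    have hA := adjugate_hessian_posDef (hvd z hzΩ) (hvp z hzΩ)
    have h2 := hA.posSemidef.trace_mul_nonneg h1
    have hAd : (hessian v z).adjugate.det = 1 := by
      rw [Matrix.det_adjugate, hvd z hzΩ, one_pow]
    have h3 := hA.le_trace_mul_of_det_eq_one (hup z hzΩ) hAd (hud z hzΩ)
    rw [hessian_sub (hu2 z hzΩ) htv, hessian_const_mul (hv2 z hzΩ), neg_sub, Matrix.mul_sub,
      Matrix.mul_smul, Matrix.adjugate_mul, hvd z hzΩ, one_smul, Matrix.trace_sub,
      Matrix.trace_smul, Matrix.trace_one, Fintype.card_fin, smul_eq_mul] at h2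
    have hn' : (0 : ℝ) < n := by exact_mod_cast hn
    nlinarith
  have h := hmax (subset_closure hx)
  simp only [Set.mem_ofPred_eq, hu0 z hzf, hv0 z hzf] at h
  linarith

/-- The comparison principle for the Dirichlet problem of `det D²u = 1`. -/
theorem le_of_det_hessian_eq_one (hn : 0 < n) (hΩ : IsOpen Ω) (hb : Bornology.IsBounded Ω)
    (huc : ContinuousOn u (closure Ω)) (hu2 : ∀ y ∈ Ω, ContDiffAt ℝ (2 : ℕ) u y)
    (hup : ∀ y ∈ Ω, (hessian u y).PosDef) (hud : ∀ y ∈ Ω, (hessian u y).det = 1)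
    (hu0 : ∀ y ∈ frontier Ω, u y = 0)
    (hvc : ContinuousOn v (closure Ω)) (hv2 : ∀ y ∈ Ω, ContDiffAt ℝ (2 : ℕ) v y)
    (hvp : ∀ y ∈ Ω, (hessian v y).PosDef) (hvd : ∀ y ∈ Ω, (hessian v y).det = 1)
    (hv0 : ∀ y ∈ frontier Ω, v y = 0) (hx : x ∈ Ω) : u x ≤ v x := by
  have h : Tendsto (fun t : ℝ => t * v x) (𝓝[<] 1) (𝓝 (v x)) := by
    have hc : Continuous fun t : ℝ => t * v x := by fun_prop
    simpa using (hc.tendsto 1).mono_left nhdsWithin_le_nhds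
  exact ge_of_tendsto h (eventually_of_mem self_mem_nhdsWithin fun t ht =>
    le_mul_of_det_hessian_eq_one hn hΩ hb huc hu2 hup hud hu0 hvc hv2 hvp hvd hv0 ht hx)

theorem IsStrictlyConvexSolution.psi_eq_of_isMaxOn (hΩ : IsOpen Ω) (hconv : Convex ℝ Ω)
    (hu : IsStrictlyConvexSolution Ω u) (hx : x ∈ Ω) (hmax : IsMaxOn (psi u) Ω x) :
    ∀ y ∈ Ω, psi u y = psi u x := by
  refine eqOn_of_isMaxOn_of_ellipticOp_nonneg (A := fun y => (hessian u y).adjugate) hΩ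
    hconv.isPreconnected
    (fun y hy => adjugate_hessian_posDef (hu.det_hessian y hy) (hu.posDef hΩ hy))
    (fun i j y hy => ?_) (fun y hy => contDiffAt_psi (hu.contDiffAt hΩ hy))
    (fun y hy => (ellipticOp_psi_nonneg (hu.contDiffAt hΩ hy) (hu.eventually_det hΩ hy)
      (hu.posDef hΩ hy)).1) hx hmax
  exact (contDiffAt_adjugate (M := fun y => hessian u y) (k := 2) (contDiffAt_hessian
    (hu.contDiffAt hΩ hy) le_rfl) i j).continuousAt.continuousWithinAt

theorem frontier_nonempty_of_isBounded (hn : 0 < n) (hne : Ω.Nonempty)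
    (hb : Bornology.IsBounded Ω) : (frontier Ω).Nonempty := by
  have : Nonempty (Fin n) := ⟨⟨0, hn⟩⟩
  refine nonempty_frontier_iff.mpr ⟨hne, fun h => ?_⟩
  rw [h] at hb
  exact NormedSpace.unbounded_univ ℝ (EuclideanSpace ℝ (Fin n)) hb

/-- With an interior maximum `ψ` is constant and any boundary point serves. Otherwise, if every
boundary point failed, each point of the closure would have a neighbourhood where `ψ` stays below
some bound less than its supremum; compactness makes the bound uniform, a contradiction. The
supremum is taken in `EReal`, so `ψ` may be unbounded. -/
theorem IsStrictlyConvexSolution.exists_frontier_limsup (hn : 0 < n) (hne : Ω.Nonempty)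
    (hΩ : IsOpen Ω) (hconv : Convex ℝ Ω) (hb : Bornology.IsBounded Ω)
    (hu : IsStrictlyConvexSolution Ω u) :
    ∃ x₀ ∈ frontier Ω, ∀ x ∈ Ω,
      (psi u x : EReal) ≤ limsup (fun y => (psi u y : EReal)) (𝓝[Ω] x₀) := by
  by_cases hmax : ∃ x₀ ∈ Ω, IsMaxOn (psi u) Ω x₀
  · obtain ⟨x₁, hx₁, hm⟩ := hmax
    have hconst := hu.psi_eq_of_isMaxOn hΩ hconv hx₁ hm
    obtain ⟨x₀, hx₀⟩ := frontier_nonempty_of_isBounded hn hne hb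
    refine ⟨x₀, hx₀, fun x hx => ?_⟩
    have : (𝓝[Ω] x₀).NeBot := mem_closure_iff_nhdsWithin_neBot.mp (frontier_subset_closure hx₀)
    have h : (fun y => (psi u y : EReal)) =ᶠ[𝓝[Ω] x₀] fun _ => (psi u x₁ : EReal) :=
      eventually_of_mem self_mem_nhdsWithin fun y hy => by simp only [hconst y hy]
    rw [limsup_congr h, limsup_const, hconst x hx]
  · by_contra! hcon
    set s : EReal := ⨆ y ∈ Ω, (psi u y : EReal) with hs
    have hle : ∀ y ∈ Ω, (psi u y : EReal) ≤ s := fun y hy => le_iSup₂_of_le y hy le_rfl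
    have hcov : ∃ b < s, ∀ y ∈ closure Ω ∩ Ω, (psi u y : EReal) ≤ b := by
      refine hb.isCompact_closure.induction_on
        (p := fun S => ∃ b < s, ∀ y ∈ S ∩ Ω, (psi u y : EReal) ≤ b) ?_ ?_ ?_ ?_
      · obtain ⟨y, hy⟩ := hne
        exact ⟨⊥, (EReal.bot_lt_coe _).trans_le (hle y hy), by simp⟩
      · rintro S T hST ⟨b, hb, h⟩
        exact ⟨b, hb, fun y hy => h y ⟨hST hy.1, hy.2⟩⟩
      · rintro S T ⟨b, hb, h⟩ ⟨b', hb', h'⟩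
        refine ⟨max b b', max_lt hb hb', ?_⟩
        rintro y ⟨hy | hy, hyΩ⟩
        · exact (h y ⟨hy, hyΩ⟩).trans (le_max_left _ _)
        · exact (h' y ⟨hy, hyΩ⟩).trans (le_max_right _ _)
      · intro x hx
        have hlim : limsup (fun y => (psi u y : EReal)) (𝓝[Ω] x) < s := by
          by_cases hxf : x ∈ frontier Ω
          · obtain ⟨y, hy, hlt⟩ := hcon x hxf
            exact hlt.trans_le (hle y hy)
          · have hxΩ := mem_of_mem_closure_of_notMem_frontier hΩ hx hxf
            have hc : Tendsto (fun y => (psi u y : EReal)) (𝓝[Ω] x) (𝓝 (psi u x : EReal)) := by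
              have h1 := (contDiffAt_psi (hu.contDiffAt hΩ hxΩ)).continuousAt
              exact (continuous_coe_real_ereal.continuousAt.tendsto.comp h1).mono_left
                nhdsWithin_le_nhds
            have : (𝓝[Ω] x).NeBot := mem_closure_iff_nhdsWithin_neBot.mp hx
            rw [hc.limsup_eq]
            refine lt_of_le_of_ne (hle x hxΩ) fun heq => hmax ⟨x, hxΩ, fun y hy => ?_⟩
            have := hle y hy
            rw [← heq] at this
            exact EReal.coe_le_coe_iff.mp this
        obtain ⟨b, hb1, hb2⟩ := exists_between hlim
        have hev := eventually_lt_of_limsup_lt hb1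
        rw [eventually_nhdsWithin_iff] at hev
        exact ⟨{y | y ∈ Ω → (psi u y : EReal) < b}, mem_nhdsWithin_of_mem_nhds hev, b, hb2,
          fun y hy => (hy.1 hy.2).le⟩
    obtain ⟨b, hbs, hb'⟩ := hcov
    exact absurd (iSup₂_le fun y hy => hb' y ⟨subset_closure hy, hy⟩ : s ≤ b) (not_le.mpr hbs)

theorem IsStrictlyConvexSolution.exists_frontier_isMaxOn (hn : 0 < n) (hne : Ω.Nonempty)
    (hΩ : IsOpen Ω) (hconv : Convex ℝ Ω) (hb : Bornology.IsBounded Ω)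
    (hu : IsStrictlyConvexSolution Ω u) {Ψ : EuclideanSpace ℝ (Fin n) → ℝ}
    (hΨ : ContinuousOn Ψ (closure Ω)) (heq : Set.EqOn Ψ (psi u) Ω) :
    ∃ x₀ ∈ frontier Ω, IsMaxOn Ψ (closure Ω) x₀ := by
  obtain ⟨z, hz, hmax⟩ := hb.isCompact_closure.exists_isMaxOn hne.closure hΨ
  by_cases hzf : z ∈ frontier Ω
  · exact ⟨z, hzf, hmax⟩
  have hzΩ := mem_of_mem_closure_of_notMem_frontier hΩ hz hzf
  have hm : IsMaxOn (psi u) Ω z := fun y hy => by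
    have : Ψ y ≤ Ψ z := hmax (subset_closure hy)
    rwa [heq hy, heq hzΩ] at this
  have hconst := hu.psi_eq_of_isMaxOn hΩ hconv hzΩ hm
  obtain ⟨x₀, hx₀⟩ := frontier_nonempty_of_isBounded hn hne hb
  have hall : Set.EqOn Ψ (fun _ => psi u z) (closure Ω) :=
    Set.EqOn.of_subset_closure (s := Ω) (fun y hy => by rw [heq hy, hconst y hy]) hΨ
      continuousOn_const subset_closure subset_rfl
  refine ⟨x₀, hx₀, fun y hy => ?_⟩
  simp [hall hy, hall (frontier_subset_closure hx₀)]

end Solution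

/-! ### Constant `ψ`, quadratic solutions, ellipsoids and balls -/

section Rigidity

variable {n : ℕ} {Ω : Set (EuclideanSpace ℝ (Fin n))} {f u : EuclideanSpace ℝ (Fin n) → ℝ}
  {x c : EuclideanSpace ℝ (Fin n)} {H : Matrix (Fin n) (Fin n) ℝ}

theorem eq_of_partialD_eq_zero (hΩ : IsOpen Ω) (hconn : IsPreconnected Ω)
    (hf : ∀ y ∈ Ω, DifferentiableAt ℝ f y) (h : ∀ y ∈ Ω, ∀ i, partialD i f y = 0)
    {y : EuclideanSpace ℝ (Fin n)} (hx : x ∈ Ω) (hy : y ∈ Ω) : f y = f x :=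
  hΩ.is_const_of_fderiv_eq_zero hconn (fun z hz => (hf z hz).differentiableWithinAt)
    (fun z hz => by
      ext v
      simp [fderiv_apply_eq_sum, h z hz]) hy hx

theorem ellipticOp_psi_eq_zero_of_const (hΩ : IsOpen Ω) {a : ℝ}
    (hconst : ∀ y ∈ Ω, psi u y = a) (hx : x ∈ Ω) (A : Matrix (Fin n) (Fin n) ℝ) :
    ellipticOp A (psi u) x = 0 := by
  have h : psi u =ᶠ[𝓝 x] fun _ => a := eventually_of_mem (hΩ.mem_nhds hx) hconst
  have h0 : ∀ i : Fin n, partialD i (fun _ : EuclideanSpace ℝ (Fin n) => a) = fun _ => 0 :=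
    fun i => funext fun y => partialD_const a i
  have h1 : hessian (psi u) x = 0 := by
    rw [hessian_congr h]
    ext i j
    simp [hessian, h0, partialD_const]
  simp [ellipticOp, h1]

/-- The equality case applies only where `∇u ≠ 0`. A nonzero third derivative at a critical point
would persist nearby, so `∇u` would vanish on a neighbourhood and `D²u` would be `0`, against `det
D²u = 1`. -/
theorem IsStrictlyConvexSolution.thirdD_eq_zero (hn : 0 < n) (hΩ : IsOpen Ω)
    (hu : IsStrictlyConvexSolution Ω u) {a : ℝ} (hconst : ∀ y ∈ Ω, psi u y = a) (hx : x ∈ Ω)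
    (k : Fin n) : thirdD u x k = 0 := by
  have hreg : ∀ y ∈ Ω, (∃ k, partialD k u y ≠ 0) → ∀ k, thirdD u y k = 0 := fun y hy =>
    ((ellipticOp_psi_nonneg (hu.contDiffAt hΩ hy) (hu.eventually_det hΩ hy) (hu.posDef hΩ hy)).2
      (ellipticOp_psi_eq_zero_of_const hΩ hconst hy _)).2
  by_contra hne
  obtain ⟨i, j, hij⟩ : ∃ i j, thirdD u x k i j ≠ 0 := by
    by_contra! h
    exact hne (by ext i j; exact h i j)
  have hc : ContinuousAt (fun y => thirdD u y k i j) x :=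
    ((contDiffAt_hessian (k := 2) (hu.contDiffAt hΩ hx) le_rfl i j).partialD (k := 1) le_rfl
      k).continuousAt
  have hgrad : ∀ᶠ y in 𝓝 x, ∀ l, partialD l u y = 0 := by
    filter_upwards [hc.eventually_ne hij, hΩ.mem_nhds hx] with y hy hyΩ
    by_contra! h
    exact hy (by rw [hreg y hyΩ h k]; rfl)
  have hzero : hessian u x = 0 := by
    ext a b
    have h : partialD a u =ᶠ[𝓝 x] fun _ => 0 := hgrad.mono fun y hy => hy a
    simp only [hessian, Matrix.of_apply]
    rw [partialD_congr h, partialD_const, Matrix.zero_apply]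
  have hdet := hu.det_hessian x hx
  have : Nonempty (Fin n) := ⟨⟨0, hn⟩⟩
  rw [hzero, Matrix.det_zero] at hdet
  exact zero_ne_one hdet

/-- The centre `c` is the interior minimum of `u`. There `u` and the quadratic have the same
gradient, so they differ by the constant `u c`; the level `m = -u c` comes from the zero boundary
values. -/
theorem IsStrictlyConvexSolution.exists_eq_sublevel_quadPoly (hn : 0 < n) (hne : Ω.Nonempty)
    (hΩ : IsOpen Ω) (hconv : Convex ℝ Ω) (hb : Bornology.IsBounded Ω)
    (hu : IsStrictlyConvexSolution Ω u) (hH : H.PosDef) (hconst : ∀ y ∈ Ω, hessian u y = H) :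
    ∃ c m, 0 < m ∧ Ω = {z | quadPoly c 0 H z < m} := by
  have hu2 : ∀ y ∈ Ω, ContDiffAt ℝ (2 : ℕ) u y := fun y hy =>
    (hu.contDiffAt hΩ hy).of_le (by norm_num)
  have hneg : ∀ y ∈ Ω, u y < 0 := fun y hy => neg_of_posDef_hessian hn hΩ hb hu.continuousOn hu2
    (fun z hz => hu.posDef hΩ hz) hu.boundary hy
  have hHs : H.IsSymm := hH.isHermitian
  obtain ⟨c, hc, hmin⟩ := hb.isCompact_closure.exists_isMinOn hne.closure hu.continuousOn
  have hcΩ : c ∈ Ω := by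
    refine mem_of_mem_closure_of_notMem_frontier hΩ hc fun hcf => ?_
    obtain ⟨y, hy⟩ := hne
    have h : u c ≤ u y := hmin (subset_closure hy)
    rw [hu.boundary c hcf] at h
    exact absurd (hneg y hy) (not_lt.mpr h)
  have hgrad : ∀ i, partialD i u c = 0 := fun i => by
    have hloc : IsLocalMin u c := (hmin.on_subset subset_closure).isLocalMin (hΩ.mem_nhds hcΩ)
    simp [partialD, hloc.fderiv_eq_zero]
  have hq2 : ∀ y, ContDiffAt ℝ (2 : ℕ) (quadPoly c 0 H) y := fun y => contDiff_quadPoly.contDiffAt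
  have hd1 : ∀ y ∈ Ω, ∀ i, partialD i (fun z => u z - quadPoly c 0 H z) y = 0 := by
    intro y hy i
    have hw2 : ∀ z ∈ Ω, ContDiffAt ℝ (2 : ℕ) (fun z => u z - quadPoly c 0 H z) z := fun z hz =>
      (hu2 z hz).sub (hq2 z)
    have h1 := eq_of_partialD_eq_zero (f := partialD i fun z => u z - quadPoly c 0 H z) hΩ
      hconv.isPreconnected (fun z hz => ((hw2 z hz).partialD (k := 1) le_rfl i).differentiableAt_nat
        le_rfl) (fun z hz j => ?_) hcΩ hy
    · rw [h1, partialD_sub ((hu2 c hcΩ).differentiableAt_nat (by simp))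
        ((hq2 c).differentiableAt_nat (by simp)), hgrad, partialD_quadPoly hHs]
      simp
    · have h2 : hessian (fun z => u z - quadPoly c 0 H z) z = 0 := by
        rw [hessian_sub (hu2 z hz) (hq2 z), hconst z hz, hessian_quadPoly hHs, sub_self]
      exact congrFun (congrFun h2 i) j
  have hq0 : quadPoly c 0 H c = 0 := by simp [quadPoly]
  have hform : ∀ y ∈ Ω, u y = quadPoly c 0 H y + u c := fun y hy => by
    have h := eq_of_partialD_eq_zero (f := fun z => u z - quadPoly c 0 H z) hΩ hconv.isPreconnected
      (fun z hz => ((hu2 z hz).sub (hq2 z)).differentiableAt_nat (by simp)) hd1 hcΩ hy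
    simp only [hq0] at h
    linarith
  have hqc : Continuous (quadPoly c 0 H) := (contDiff_quadPoly (m := 0)).continuous
  have hformc : Set.EqOn u (fun y => quadPoly c 0 H y + u c) (closure Ω) :=
    Set.EqOn.of_subset_closure hform hu.continuousOn (by fun_prop) subset_closure subset_rfl
  refine ⟨c, -u c, by linarith [hneg c hcΩ], Set.Subset.antisymm (fun y hy => ?_) fun y hy => ?_⟩
  · have h1 := hneg y hy
    rw [hform y hy] at h1
    simp only [Set.mem_ofPred_eq]
    linarith
  · by_contra hyΩ
    -- A point outside `Ω` is joined to `c` by a segment crossing the boundary, where the quadratic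
    -- equals `m`. By homogeneity its value at `y` is then at least `m`.
    obtain ⟨z, hz, hzf⟩ : (segment ℝ c y ∩ frontier Ω).Nonempty := by
      by_contra hemp
      have hsub : segment ℝ c y ⊆ Ω :=
        (convex_segment c y).isPreconnected.subset_of_closure_inter_subset hΩ
          ⟨c, left_mem_segment ℝ c y, hcΩ⟩ fun z hz => by
            by_contra hzΩ
            exact hemp ⟨z, hz.2, by rw [hΩ.frontier_eq]; exact ⟨hz.1, hzΩ⟩⟩
      exact hyΩ (hsub (right_mem_segment ℝ c y))
    have h0 := hformc (frontier_subset_closure hzf)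
    rw [hu.boundary z hzf] at h0
    rw [segment_eq_image'] at hz
    obtain ⟨t, ht, rfl⟩ := hz
    have hscale : quadPoly c 0 H (c + t • (y - c)) = t ^ 2 * quadPoly c 0 H y := by
      simp only [quadPoly, Pi.zero_apply, zero_mul, Finset.sum_const_zero, zero_add,
        PiLp.add_apply, PiLp.smul_apply, PiLp.sub_apply, smul_eq_mul, add_sub_cancel_left,
        Finset.mul_sum]
      exact Finset.sum_congr rfl fun i _ => Finset.sum_congr rfl fun j _ => by ring
    simp only [hscale, Set.mem_ofPred_eq] at h0 hy
    have hm := hneg c hcΩ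
    have ht2 : t ^ 2 ≤ 1 := pow_le_one₀ ht.1 ht.2
    have hq : 0 < quadPoly c 0 H y := by
      by_contra! hq
      linarith [mul_nonpos_of_nonneg_of_nonpos (sq_nonneg t) hq]
    linarith [mul_le_mul_of_nonneg_right ht2 hq.le]

theorem quadPoly_zero_eq (z : EuclideanSpace ℝ (Fin n)) :
    quadPoly c 0 H z = (1 / 2) * ((z - c).ofLp ⬝ᵥ H.mulVec (z - c).ofLp) := by
  simp only [quadPoly, Pi.zero_apply, zero_mul, Finset.sum_const_zero, zero_add, dotProduct,
    Matrix.mulVec, Finset.mul_sum, WithLp.ofLp_sub, Pi.sub_apply]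
  exact Finset.sum_congr rfl fun i _ => Finset.sum_congr rfl fun j _ => by ring

theorem quadPoly_zero_one_eq (z : EuclideanSpace ℝ (Fin n)) :
    quadPoly c 0 1 z = (1 / 2) * dist z c ^ 2 := by
  rw [quadPoly_zero_eq, Matrix.one_mulVec, dist_eq_norm, EuclideanSpace.real_norm_sq_eq]
  simp [dotProduct, sq]

theorem isEllipsoid_iff : IsEllipsoid Ω ↔
    ∃ (c : EuclideanSpace ℝ (Fin n)) (H : Matrix (Fin n) (Fin n) ℝ) (m : ℝ), H.PosDef ∧ 0 < m ∧
      Ω = {z | quadPoly c 0 H z < m} := by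
  constructor
  · rintro ⟨c, A, hA, rfl⟩
    refine ⟨c, A, 1 / 2, hA, by norm_num, ?_⟩
    ext z
    simp only [Set.mem_ofPred_eq, quadPoly_zero_eq]
    constructor <;> intro h <;> linarith
  · rintro ⟨c, H, m, hH, hm, rfl⟩
    refine ⟨c, (1 / (2 * m)) • H, hH.smul (by positivity), ?_⟩
    ext z
    simp only [Set.mem_ofPred_eq, quadPoly_zero_eq, Matrix.smul_mulVec, dotProduct_smul,
      smul_eq_mul]
    rw [one_div_mul_eq_div (2 * m), div_lt_one (by positivity)]
    constructor <;> intro h <;> linarith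

theorem isBall_iff : IsBall Ω ↔ ∃ (c : EuclideanSpace ℝ (Fin n)) (m : ℝ), 0 < m ∧
    Ω = {z | quadPoly c 0 1 z < m} := by
  constructor
  · rintro ⟨c, r, hr, rfl⟩
    refine ⟨c, r ^ 2 / 2, by positivity, ?_⟩
    ext z
    simp only [Set.mem_ofPred_eq, quadPoly_zero_one_eq, Metric.mem_ball]
    rw [← pow_lt_pow_iff_left₀ dist_nonneg hr.le two_ne_zero]
    constructor <;> intro h <;> linarith
  · rintro ⟨c, m, hm, rfl⟩
    refine ⟨c, Real.sqrt (2 * m), by positivity, ?_⟩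
    ext z
    simp only [Set.mem_ofPred_eq, quadPoly_zero_one_eq, Metric.mem_ball]
    rw [Real.lt_sqrt dist_nonneg]
    constructor <;> intro h <;> linarith

/-- The quadratic minus `m` solves the same Dirichlet problem, so comparison in both directions
identifies it with `u`. -/
theorem IsStrictlyConvexSolution.eq_quadPoly (hn : 0 < n) (hΩ : IsOpen Ω)
    (hb : Bornology.IsBounded Ω) (hu : IsStrictlyConvexSolution Ω u) (hH : H.PosDef)
    (hdet : H.det = 1) {m : ℝ} (hΩeq : Ω = {z | quadPoly c 0 H z < m}) (hx : x ∈ Ω) :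
    u x = quadPoly c 0 H x - m := by
  have hHs : H.IsSymm := hH.isHermitian
  have hqc : Continuous (quadPoly c 0 H) := (contDiff_quadPoly (m := 0)).continuous
  have hv2 : ∀ y ∈ Ω, ContDiffAt ℝ (2 : ℕ) (fun z => quadPoly c 0 H z - m) y := fun y _ =>
    contDiff_quadPoly.contDiffAt.sub contDiffAt_const
  have hvh : ∀ y, hessian (fun z => quadPoly c 0 H z - m) y = H := fun y => by
    rw [hessian_sub contDiff_quadPoly.contDiffAt contDiffAt_const, hessian_quadPoly hHs]
    have h0 : ∀ i : Fin n, partialD i (fun _ : EuclideanSpace ℝ (Fin n) => m) = fun _ => 0 :=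
      fun i => funext fun y => partialD_const m i
    ext i j
    simp [hessian, h0, partialD_const]
  have hvc : ContinuousOn (fun z => quadPoly c 0 H z - m) (closure Ω) := by fun_prop
  have hv0 : ∀ y ∈ frontier Ω, quadPoly c 0 H y - m = 0 := by
    intro y hy
    rw [hΩeq] at hy
    have := frontier_lt_subset_eq hqc continuous_const hy
    simp only [Set.mem_ofPred_eq] at this
    linarith
  have hu2 : ∀ y ∈ Ω, ContDiffAt ℝ (2 : ℕ) u y := fun y hy =>
    (hu.contDiffAt hΩ hy).of_le (by norm_num)
  have hup : ∀ y ∈ Ω, (hessian u y).PosDef := fun y hy => hu.posDef hΩ hy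
  have hvp : ∀ y ∈ Ω, (hessian (fun z => quadPoly c 0 H z - m) y).PosDef := fun y _ =>
    (hvh y).symm ▸ hH
  have hvd : ∀ y ∈ Ω, (hessian (fun z => quadPoly c 0 H z - m) y).det = 1 := fun y _ => by
    rw [hvh, hdet]
  exact le_antisymm
    (le_of_det_hessian_eq_one hn hΩ hb hu.continuousOn hu2 hup hu.det_hessian hu.boundary hvc hv2
      hvp hvd hv0 hx)
    (le_of_det_hessian_eq_one hn hΩ hb hvc hv2 hvp hvd hv0 hu.continuousOn hu2 hup hu.det_hessian
      hu.boundary hx)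

theorem IsStrictlyConvexSolution.psi_eq_quadPoly (hn : 0 < n) (hΩ : IsOpen Ω)
    (hb : Bornology.IsBounded Ω) (hu : IsStrictlyConvexSolution Ω u) (hH : H.PosDef)
    (hdet : H.det = 1) {m : ℝ} (hΩeq : Ω = {z | quadPoly c 0 H z < m}) (hx : x ∈ Ω) :
    psi u x = (∑ k, ∑ l, (H l l * (H.mulVec (x - c).ofLp k * H.mulVec (x - c).ofLp k) -
      H l k * (H.mulVec (x - c).ofLp k * H.mulVec (x - c).ofLp l))) -
      2 * ((n : ℝ) - 1) * (quadPoly c 0 H x - m) := by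
  have hHs : H.IsSymm := hH.isHermitian
  have heq : u =ᶠ[𝓝 x] fun z => quadPoly c 0 H z + -m := by
    refine eventually_of_mem (hΩ.mem_nhds hx) fun y hy => ?_
    simp only [← sub_eq_add_neg]
    exact hu.eq_quadPoly hn hΩ hb hH hdet hΩeq hy
  have hp : ∀ y k, partialD k (fun z => quadPoly c 0 H z + -m) y = H.mulVec (y - c).ofLp k := by
    intro y k
    rw [partialD_add ((contDiff_quadPoly (m := 1)).contDiffAt.differentiableAt_nat le_rfl)
      (differentiableAt_const _), partialD_const, partialD_quadPoly hHs]
    simp [Matrix.mulVec, dotProduct]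
  have hhess : hessian (fun z => quadPoly c 0 H z + -m) x = H := by
    have h0 : ∀ i : Fin n, partialD i (fun _ : EuclideanSpace ℝ (Fin n) => -m) = fun _ => 0 :=
      fun i => funext fun y => partialD_const (-m) i
    rw [hessian_add contDiff_quadPoly.contDiffAt contDiffAt_const, hessian_quadPoly hHs]
    ext i j
    simp [hessian, h0, partialD_const]
  rw [psi_eq, hessian_congr heq, hhess, heq.self_of_nhds]
  simp only [partialD_congr heq, hp]
  ring

end Rigidity

/-! ### The main theorem -/

theorem theorem1p2 (n : ℕ) (hn : 2 ≤ n) (Ω : Set (EuclideanSpace ℝ (Fin n)))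
    (hne : Ω.Nonempty) (hopen : IsOpen Ω) (hconv : Convex ℝ Ω)
    (hbdd : Bornology.IsBounded Ω)
    (u : EuclideanSpace ℝ (Fin n) → ℝ) (hu : IsStrictlyConvexSolution Ω u) :
    (∃ x₀ ∈ frontier Ω, ∀ x ∈ Ω,
      (psi u x : EReal) ≤ limsup (fun y => (psi u y : EReal)) (𝓝[Ω] x₀)) ∧
    (∀ Ψ : EuclideanSpace ℝ (Fin n) → ℝ,
      ContinuousOn Ψ (closure Ω) → Set.EqOn Ψ (psi u) Ω →
        ∃ x₀ ∈ frontier Ω, IsMaxOn Ψ (closure Ω) x₀) ∧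
    (n = 2 → ((∃ x₀ ∈ Ω, IsMaxOn (psi u) Ω x₀) ↔ IsEllipsoid Ω)) ∧
    (3 ≤ n → ((∃ x₀ ∈ Ω, IsMaxOn (psi u) Ω x₀) ↔ IsBall Ω)) := by
  have hn0 : 0 < n := by omega
  refine ⟨hu.exists_frontier_limsup hn0 hne hopen hconv hbdd,
    fun Ψ hΨ heq => hu.exists_frontier_isMaxOn hn0 hne hopen hconv hbdd hΨ heq,
    fun hn2 => ⟨?_, fun hE => ?_⟩, fun hn3 => ⟨?_, fun hB => ?_⟩⟩
  · rintro ⟨x₀, hx₀, hmax⟩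
    have hconst := hu.psi_eq_of_isMaxOn hopen hconv hx₀ hmax
    refine isEllipsoid_iff.mpr ?_
    obtain ⟨c, m, hm, hΩ⟩ := hu.exists_eq_sublevel_quadPoly hn0 hne hopen hconv hbdd
      (hu.posDef hopen hx₀) fun y hy => by
        ext i j
        refine eq_of_partialD_eq_zero (f := fun z => hessian u z i j) hopen hconv.isPreconnected
          (fun z hz => (contDiffAt_hessian (k := 2) (hu.contDiffAt hopen hz) le_rfl i
            j).differentiableAt_nat (by simp)) (fun z hz k => ?_) hx₀ hy
        exact congrFun (congrFun (hu.thirdD_eq_zero hn0 hopen hconst hz k) i) j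
    exact ⟨c, _, m, hu.posDef hopen hx₀, hm, hΩ⟩
  · subst hn2
    obtain ⟨c, H, m, hH, hm, hΩ⟩ := isEllipsoid_iff.mp hE
    have hd := hH.det_pos
    -- Rescaling the quadratic form to determinant `1`; in dimension two `det (s • H) = s² det H`.
    set s := (Real.sqrt H.det)⁻¹ with hs
    have hs0 : 0 < s := by positivity
    have hs2 : s ^ 2 * H.det = 1 := by
      rw [hs, inv_pow, Real.sq_sqrt hd.le, inv_mul_cancel₀ hd.ne']
    have hsH : (s • H).PosDef := hH.smul hs0
    have hsd : (s • H).det = 1 := by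
      rw [Matrix.det_smul, Fintype.card_fin, hs2]
    have hΩ' : Ω = {z | quadPoly c 0 (s • H) z < s * m} := by
      rw [hΩ]
      ext z
      simp only [Set.mem_ofPred_eq, quadPoly_zero_eq, Matrix.smul_mulVec, dotProduct_smul,
        smul_eq_mul]
      rw [mul_left_comm, mul_lt_mul_iff_right₀ hs0]
    -- In dimension two the gradient of `σ₂` is the cofactor matrix, the inverse of the Hessian
    -- here, so the gradient term of `ψ` is twice the quadratic and cancels the nonconstant part of
    -- `-2 u`.
    have hval : ∀ x ∈ Ω, psi u x = 2 * (s * m) := by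
      intro x hx
      rw [hu.psi_eq_quadPoly hn0 hopen hbdd hsH hsd hΩ' hx, quadPoly_zero_eq]
      generalize s • H = G at hsH hsd
      have hsym : G 1 0 = G 0 1 := (show G.IsSymm from hsH.isHermitian).apply 0 1
      rw [Matrix.det_fin_two] at hsd
      simp only [Fin.sum_univ_two, Matrix.mulVec, dotProduct, hsym] at hsd ⊢
      generalize (x - c).ofLp 0 = a
      generalize (x - c).ofLp 1 = b
      push_cast
      linear_combination (G 0 0 * a ^ 2 + 2 * G 0 1 * a * b + G 1 1 * b ^ 2) * hsd
    obtain ⟨x₀, hx₀⟩ := hne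
    exact ⟨x₀, hx₀, fun y hy => by simp [hval y hy, hval x₀ hx₀]⟩
  · rintro ⟨x₀, hx₀, hmax⟩
    have hconst := hu.psi_eq_of_isMaxOn hopen hconv hx₀ hmax
    exact isBall_iff.mpr (hu.exists_eq_sublevel_quadPoly hn0 hne hopen hconv hbdd
      Matrix.PosDef.one fun y hy => ((ellipticOp_psi_nonneg (hu.contDiffAt hopen hy)
        (hu.eventually_det hopen hy) (hu.posDef hopen hy)).2
          (ellipticOp_psi_eq_zero_of_const hopen hconst hy _)).1 hn3)
  · obtain ⟨c, m, hm, hΩ⟩ := isBall_iff.mp hB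
    have hval : ∀ x ∈ Ω, psi u x = 2 * ((n : ℝ) - 1) * m := by
      intro x hx
      rw [hu.psi_eq_quadPoly hn0 hopen hbdd Matrix.PosDef.one Matrix.det_one hΩ hx,
        quadPoly_zero_eq, Matrix.one_mulVec]
      simp only [Matrix.one_apply, Finset.sum_sub_distrib, if_true, dotProduct, one_mul, ite_mul,
        zero_mul, Finset.sum_ite_eq', Finset.mem_univ, Finset.sum_const, Finset.card_univ,
        Fintype.card_fin, nsmul_eq_mul, ← Finset.mul_sum]
      ring
    obtain ⟨x₀, hx₀⟩ := hne
    exact ⟨x₀, hx₀, fun y hy => by simp [hval y hy, hval x₀ hx₀]⟩
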